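/- Let $(\mathcal L,\otimes,1)$ be a symmetric monoidal category that is a model of classical linear logic in the sense of Schalk: it is $*$-autonomous (closed, with a dualizing object $\bot$ such that $A\to(A\multimap\bot)\multimap\bot$ is always invertible), has finite products, and carries a linear exponential comonad $!$, that is, a symmetric monoidal comonad with monoidal natural transformations $e_A:\,!A\to 1$, $d_A:\,!A\to\,!A\otimes\,!A$ such that each $(!A,d_A,e_A)$ is a commutative comonoid, $e_A$ and $d_A$ are coalgebra morphisms, and every coalgebra morphism between free coalgebras is a comonoid morphism. Recall that an LPC model $(\mathcal L,\mathcal P,\mathcal C)$ consists of the following. 1. A symmetric linearly distributive structure with negation $(\otimes,\odot,(-)^\perp)$ on $\mathcal L$ (Cockett–Seely), with finite products and coproducts. That is: a second symmetric monoidal structure $\odot$ (the cotensor, or "par") with unit $\bot_{\mathcal L}$; a natural map $A\otimes(B \odot C)\to(A\otimes B) \odot C$ coherent with both monoidal structures; and maps $A^\perp\otimes A\to\bot_{\mathcal L}$, $1\to A \odot A^\perp$ satisfying the two triangle identities. 2. Symmetric monoidal categories $(\mathcal P,\otimes)$ and $(\mathcal C,\odot)$ in symmetric monoidal duality via contravariant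 functors $(-)^*:\mathcal P\to\mathcal C$ (monoidal) and $(-)_*:\mathcal C\to\mathcal P$ (comonoidal), with natural isomorphisms $(C_*)^*\cong C$ and $P\cong(P^*)_*$. 3. Monoidal natural transformations $P\to 1$, $P\to P\otimes P$ making every object of $\mathcal P$ a commutative comonoid, and comonoidal natural transformations $1_{\mathcal C}\to C$, $C \odot C\to C$, where $1_{\mathcal C}$ is the unit of $(\mathcal C,\odot)$, making every object of $\mathcal C$ a commutative monoid, interchanged by the duality. 4. A symmetric monoidal adjunction $F_!\dashv\lceil-\rceil$ with $F_!:(\mathcal P,\otimes)\to(\mathcal L,\otimes)$, and a symmetric comonoidal adjunction $\lfloor-\rfloor\dashv F_?$ with $F_?:(\mathcal C,\odot)\to(\mathcal L,\odot)$, together with natural isomorphisms $(F_!P)^\perp\cong F_?(P^*)$ and $\lceil A\rceil^*\cong\lfloor A^\perp\rfloor$. Then there is a symmetric monoidal category $\mathcal P$ such that $(\mathcal L,\mathcal P,\mathcal P^{\mathrm{op}})$ carries the structure of an LPC model whose tensor on $\mathcal L$ is the given one, with the following two properties. Its negation is that of the $*$-autonomous category: $\bot_{\mathcal L}\cong\bot$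 and $A^\perp\cong A\multimap\bot$, with $A^\perp\otimes A\to\bot_{\mathcal L}$ corresponding to evaluation. Its adjunction $F_!\dashv\lceil-\rceil$ decomposes $!$: there is an isomorphism $F_!\lceil-\rceil\cong\,!$ of monoidal comonads that respects the comonoid structures $e$, $d$. -/

import Mathlib

open CategoryTheory MonoidalCategory Opposite

universe v u v₁ u₁ v₂ u₂ v₃ u₃

namespace LPC

/-- The opposite of a symmetric monoidal category is symmetric monoidal. -/
instance symmetricCategoryOp {C : Type u} [Category.{v} C] [MonoidalCategory C]
    [SymmetricCategory C] : SymmetricCategory Cᵒᵖ where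
  toBraidedCategory := inferInstance
  symmetry X Y := Quiver.Hom.unop_inj
    (SymmetricCategory.symmetry (unop X) (unop Y))

/-! ### Symmetric monoidal and comonoidal functors and adjunctions

A symmetric monoidal functor is `CategoryTheory.Functor.LaxBraided`, and a monoidal natural
transformation is `CategoryTheory.NatTrans.IsMonoidal`. -/

section Functors

variable {X : Type u₁} [Category.{v₁} X] [MonoidalCategory X]
  {Y : Type u₂} [Category.{v₂} Y] [MonoidalCategory Y]

/-- A symmetric comonoidal functor: an oplax monoidal functor that respects the symmetries. -/
class OplaxBraided [SymmetricCategory X] [SymmetricCategory Y] (F : X ⥤ Y)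
    extends F.OplaxMonoidal where
  braided : ∀ A B : X,
    Functor.OplaxMonoidal.δ F A B ≫ (β_ (F.obj A) (F.obj B)).hom =
      F.map (β_ A B).hom ≫ Functor.OplaxMonoidal.δ F B A

/-- A comonoidal natural transformation between comonoidal functors. -/
structure IsComonoidal {F G : X ⥤ Y} [F.OplaxMonoidal] [G.OplaxMonoidal] (τ : F ⟶ G) :
    Prop where
  unit : τ.app (𝟙_ X) ≫ Functor.OplaxMonoidal.η G = Functor.OplaxMonoidal.η F
  tensor : ∀ A B : X,
    τ.app (A ⊗ B) ≫ Functor.OplaxMonoidal.δ G A B =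
      Functor.OplaxMonoidal.δ F A B ≫ (τ.app A ⊗ₘ τ.app B)

end Functors

section Adjunctions

variable {X : Type u₁} [Category.{v₁} X] [MonoidalCategory X] [SymmetricCategory X]
  {Y : Type u₂} [Category.{v₂} Y] [MonoidalCategory Y] [SymmetricCategory Y]

/-- A symmetric monoidal adjunction `F ⊣ G`: both functors are symmetric (lax) monoidal,
the unit and the counit are monoidal natural transformations. -/
structure SymMonoidalAdjunction (F : X ⥤ Y) (G : Y ⥤ X) where
  [leftLax : F.LaxBraided]
  [rightLax : G.LaxBraided]
  adj : F ⊣ G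
  unit_monoidal : NatTrans.IsMonoidal adj.unit
  counit_monoidal : NatTrans.IsMonoidal adj.counit

/-- A symmetric comonoidal adjunction `F ⊣ G`: both functors are symmetric comonoidal,
the unit and the counit are comonoidal natural transformations. -/
structure SymComonoidalAdjunction (F : X ⥤ Y) (G : Y ⥤ X) where
  [leftOplax : OplaxBraided F]
  [rightOplax : OplaxBraided G]
  adj : F ⊣ G
  unit_comonoidal : IsComonoidal adj.unit
  counit_comonoidal : IsComonoidal adj.counit

end Adjunctions

/-! ### Symmetric linearly distributive categories with negation -/

/-- A second symmetric monoidal structure on a category, written `par`, with unit `bot`. -/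
structure ParStructure (L : Type u) [Category.{v} L] where
  mon : MonoidalCategory L
  symm : @SymmetricCategory L _ mon

namespace ParStructure

variable {L : Type u} [Category.{v} L] (D : ParStructure L)

/-- The cotensor `A ⅋ B`. -/
abbrev par (A B : L) : L := D.mon.tensorObj A B

/-- The unit of the cotensor. -/
abbrev bot : L := D.mon.tensorUnit

/-- The action of the cotensor on morphisms. -/
abbrev parHom {A A' B B' : L} (f : A ⟶ A') (g : B ⟶ B') : D.par A B ⟶ D.par A' B' :=
  D.mon.tensorHom f g

/-- `(A ⅋ B) ⅋ C ≅ A ⅋ (B ⅋ C)`. -/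
abbrev parAssoc (A B C : L) : D.par (D.par A B) C ≅ D.par A (D.par B C) :=
  D.mon.associator A B C

/-- `⊥ ⅋ A ≅ A`. -/
abbrev parLeft (A : L) : D.par D.bot A ≅ A := D.mon.leftUnitor A

/-- `A ⅋ ⊥ ≅ A`. -/
abbrev parRight (A : L) : D.par A D.bot ≅ A := D.mon.rightUnitor A

/-- `A ⅋ B ≅ B ⅋ A`. -/
abbrev parSwap (A B : L) : D.par A B ≅ D.par B A := D.symm.braiding A B

/-- The mirror image `(A ⅋ B) ⊗ C ⟶ A ⅋ (B ⊗ C)` of a family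
`A ⊗ (B ⅋ C) ⟶ (A ⊗ B) ⅋ C`, obtained by conjugating with the symmetries. -/
def mirror [MonoidalCategory L] [SymmetricCategory L]
    (dist : ∀ A B C : L, A ⊗ D.par B C ⟶ D.par (A ⊗ B) C) (A B C : L) :
    D.par A B ⊗ C ⟶ D.par A (B ⊗ C) :=
  (β_ (D.par A B) C).hom ≫ (C ◁ (D.parSwap A B).hom) ≫ dist C B A ≫
    (D.parSwap (C ⊗ B) A).hom ≫ D.parHom (𝟙 A) (β_ C B).hom

end ParStructure

/-- A symmetric linearly distributive structure on a symmetric monoidal category `(L, ⊗)`: a second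
symmetric monoidal structure `⅋` and a natural linear distribution
`A ⊗ (B ⅋ C) ⟶ (A ⊗ B) ⅋ C` subject to the Cockett-Seely coherence conditions. -/
structure LinearDistributive (L : Type u) [Category.{v} L] [MonoidalCategory L]
    [SymmetricCategory L] where
  /-- the cotensor -/
  cot : ParStructure L
  dist : ∀ A B C : L, A ⊗ cot.par B C ⟶ cot.par (A ⊗ B) C
  dist_naturality : ∀ {A A' B B' C C' : L} (f : A ⟶ A') (g : B ⟶ B') (h : C ⟶ C'),
    (f ⊗ₘ cot.parHom g h) ≫ dist A' B' C' =
      dist A B C ≫ cot.parHom (f ⊗ₘ g) h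
  /-- distribution and the unit of `⊗` -/
  dist_tensorUnit : ∀ A B : L,
    dist (𝟙_ L) A B ≫ cot.parHom (λ_ A).hom (𝟙 B) =
      (λ_ (cot.par A B)).hom
  /-- distribution and the unit of `⅋` -/
  dist_parUnit : ∀ A B : L,
    dist A B cot.bot ≫ (cot.parRight (A ⊗ B)).hom =
      A ◁ (cot.parRight B).hom
  /-- distribution and the associativity of `⊗` -/
  dist_tensorAssoc : ∀ A B C D : L,
    dist (A ⊗ B) C D ≫ cot.parHom (α_ A B C).hom (𝟙 D) =
      (α_ A B (cot.par C D)).hom ≫ (A ◁ dist B C D) ≫ dist A (B ⊗ C) D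
  /-- distribution and the associativity of `⅋` -/
  dist_parAssoc : ∀ A B C D : L,
    (A ◁ (cot.parAssoc B C D).hom) ≫ dist A B (cot.par C D) =
      dist A (cot.par B C) D ≫ cot.parHom (dist A B C) (𝟙 D) ≫
        (cot.parAssoc (A ⊗ B) C D).hom
  /-- the two maps `(A ⅋ B) ⊗ (C ⅋ D) ⟶ A ⅋ ((B ⊗ C) ⅋ D)` agree -/
  dist_mirror_par : ∀ A B C D : L,
    dist (cot.par A B) C D ≫
        cot.parHom (cot.mirror dist A B C) (𝟙 D) ≫
        (cot.parAssoc A (B ⊗ C) D).hom =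
      cot.mirror dist A B (cot.par C D) ≫
        cot.parHom (𝟙 A) (dist B C D)
  /-- the two maps `(A ⊗ (B ⅋ C)) ⊗ D ⟶ (A ⊗ B) ⅋ (C ⊗ D)` agree -/
  dist_mirror_tensor : ∀ A B C D : L,
    (dist A B C ▷ D) ≫ cot.mirror dist (A ⊗ B) C D =
      (α_ A (cot.par B C) D).hom ≫
        (A ◁ cot.mirror dist B C D) ≫ dist A B (C ⊗ D)

/-- A symmetric linearly distributive structure with negation. -/
structure LinearDistributiveNeg (L : Type u) [Category.{v} L] [MonoidalCategory L]
    [SymmetricCategory L] extends LinearDistributive L where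
  neg : L → L
  γbot : ∀ A : L, neg A ⊗ A ⟶ cot.bot
  γone : ∀ A : L, 𝟙_ L ⟶ cot.par A (neg A)
  /-- `A ≅ 1 ⊗ A ⟶ (A ⅋ A^⊥) ⊗ A ⟶ A ⅋ (A^⊥ ⊗ A) ⟶ A ⅋ ⊥ ≅ A` is the identity -/
  triangle : ∀ A : L,
    (λ_ A).inv ≫ (γone A ▷ A) ≫ cot.mirror dist A (neg A) A ≫
      cot.parHom (𝟙 A) (γbot A) ≫ (cot.parRight A).hom = 𝟙 A
  /-- `A^⊥ ≅ A^⊥ ⊗ 1 ⟶ A^⊥ ⊗ (A ⅋ A^⊥) ⟶ (A^⊥ ⊗ A) ⅋ A^⊥ ⟶ ⊥ ⅋ A^⊥ ≅ A^⊥` is the identity -/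
  triangle_neg : ∀ A : L,
    (ρ_ (neg A)).inv ≫ (neg A ◁ γone A) ≫ dist (neg A) A (neg A) ≫
      cot.parHom (γbot A) (𝟙 (neg A)) ≫ (cot.parLeft (neg A)).hom =
        𝟙 (neg A)

/-- The action `f^⊥ : B^⊥ ⟶ A^⊥` of the negation on a morphism `f : A ⟶ B`:
`B^⊥ ≅ B^⊥ ⊗ 1 ⟶ B^⊥ ⊗ (A ⅋ A^⊥) ⟶ B^⊥ ⊗ (B ⅋ A^⊥) ⟶ (B^⊥ ⊗ B) ⅋ A^⊥ ⟶ ⊥ ⅋ A^⊥ ≅ A^⊥`. -/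
def LinearDistributiveNeg.negMap {L : Type u} [Category.{v} L] [MonoidalCategory L]
    [SymmetricCategory L] (N : LinearDistributiveNeg L) {A B : L} (f : A ⟶ B) :
    N.neg B ⟶ N.neg A :=
  (ρ_ (N.neg B)).inv ≫ (N.neg B ◁ N.γone A) ≫ (N.neg B ◁ N.cot.parHom f (𝟙 (N.neg A))) ≫
    N.dist (N.neg B) B (N.neg A) ≫ N.cot.parHom (N.γbot B) (𝟙 (N.neg A)) ≫
      (N.cot.parLeft (N.neg A)).hom

/-! ### Symmetric monoidal categories in duality -/

/-- A duality between symmetric monoidal categories `P` and `C`: contravariant functors `star` from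
`P` to `C`, symmetric monoidal, and `lowerStar` from `C` to `P`, symmetric comonoidal, with natural
isomorphisms `(C_*)^* ≅ C` and `P ≅ (P^*)_*` that are the (monoidal) counit and unit of a dual
equivalence. -/
structure SymMonoidalDuality (P : Type u₁) [Category.{v₁} P] [MonoidalCategory P]
    [SymmetricCategory P] (C : Type u₂) [Category.{v₂} C] [MonoidalCategory C]
    [SymmetricCategory C] where
  star : Pᵒᵖ ⥤ C
  lowerStar : Cᵒᵖ ⥤ P
  [starLax : star.LaxBraided]
  [lowerStarOplax : OplaxBraided lowerStar]
  counit : lowerStar.rightOp ⋙ star ≅ 𝟭 C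
  unit : 𝟭 P ≅ star.rightOp ⋙ lowerStar
  star_unit : ∀ X : P, star.map (unit.hom.app X).op = counit.hom.app (star.obj (op X))
  lowerStar_counit : ∀ Y : C,
    lowerStar.map (counit.hom.app Y).op = unit.hom.app (lowerStar.obj (op Y))
  counit_tensor : ∀ Y Z : C,
    Functor.LaxMonoidal.μ star (op (lowerStar.obj (op Y))) (op (lowerStar.obj (op Z))) ≫
        star.map (Functor.OplaxMonoidal.δ lowerStar (op Y) (op Z)).op ≫
        counit.hom.app (Y ⊗ Z) =
      (counit.hom.app Y ⊗ₘ counit.hom.app Z)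
  counit_tensorUnit :
    Functor.LaxMonoidal.ε star ≫ star.map (Functor.OplaxMonoidal.η lowerStar).op ≫
      counit.hom.app (𝟙_ C) = 𝟙 (𝟙_ C)
  unit_tensor : ∀ X Y : P,
    unit.hom.app (X ⊗ Y) ≫
        lowerStar.map (Functor.LaxMonoidal.μ star (op X) (op Y)).op ≫
        Functor.OplaxMonoidal.δ lowerStar (op (star.obj (op X))) (op (star.obj (op Y))) =
      (unit.hom.app X ⊗ₘ unit.hom.app Y)
  unit_tensorUnit :
    unit.hom.app (𝟙_ P) ≫ lowerStar.map (Functor.LaxMonoidal.ε star).op ≫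
      Functor.OplaxMonoidal.η lowerStar = 𝟙 (𝟙_ P)

attribute [instance] SymMonoidalDuality.starLax SymMonoidalDuality.lowerStarOplax

/-! ### Natural commutative comonoids and monoids -/

/-- Monoidal natural transformations `e_X : X ⟶ 1` and `d_X : X ⟶ X ⊗ X` that make every object
a commutative comonoid. -/
structure NaturalComonoids (P : Type u) [Category.{v} P] [MonoidalCategory P]
    [SymmetricCategory P] where
  e : ∀ X : P, X ⟶ 𝟙_ P
  d : ∀ X : P, X ⟶ X ⊗ X
  e_naturality : ∀ {X Y : P} (f : X ⟶ Y), f ≫ e Y = e X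
  d_naturality : ∀ {X Y : P} (f : X ⟶ Y), f ≫ d Y = d X ≫ (f ⊗ₘ f)
  e_tensor : ∀ X Y : P, e (X ⊗ Y) = (e X ⊗ₘ e Y) ≫ (λ_ (𝟙_ P)).hom
  e_tensorUnit : e (𝟙_ P) = 𝟙 (𝟙_ P)
  d_tensor : ∀ X Y : P, d (X ⊗ Y) = (d X ⊗ₘ d Y) ≫ tensorμ X X Y Y
  d_tensorUnit : d (𝟙_ P) = (λ_ (𝟙_ P)).inv
  counit_left : ∀ X : P, d X ≫ (e X ▷ X) = (λ_ X).inv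
  counit_right : ∀ X : P, d X ≫ (X ◁ e X) = (ρ_ X).inv
  coassoc : ∀ X : P, d X ≫ (d X ▷ X) ≫ (α_ X X X).hom = d X ≫ (X ◁ d X)
  cocomm : ∀ X : P, d X ≫ (β_ X X).hom = d X

/-- Comonoidal natural transformations `e_X : 1 ⟶ X` and `d_X : X ⊗ X ⟶ X` that make every object
a commutative monoid. -/
structure NaturalMonoids (C : Type u) [Category.{v} C] [MonoidalCategory C]
    [SymmetricCategory C] where
  e : ∀ X : C, 𝟙_ C ⟶ X
  d : ∀ X : C, X ⊗ X ⟶ X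
  e_naturality : ∀ {X Y : C} (f : X ⟶ Y), e X ≫ f = e Y
  d_naturality : ∀ {X Y : C} (f : X ⟶ Y), d X ≫ f = (f ⊗ₘ f) ≫ d Y
  e_tensor : ∀ X Y : C, e (X ⊗ Y) = (λ_ (𝟙_ C)).inv ≫ (e X ⊗ₘ e Y)
  e_tensorUnit : e (𝟙_ C) = 𝟙 (𝟙_ C)
  d_tensor : ∀ X Y : C, d (X ⊗ Y) = tensorμ X Y X Y ≫ (d X ⊗ₘ d Y)
  d_tensorUnit : d (𝟙_ C) = (λ_ (𝟙_ C)).hom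
  unit_left : ∀ X : C, (e X ▷ X) ≫ d X = (λ_ X).hom
  unit_right : ∀ X : C, (X ◁ e X) ≫ d X = (ρ_ X).hom
  assoc : ∀ X : C, (d X ▷ X) ≫ d X = (α_ X X X).hom ≫ (X ◁ d X) ≫ d X
  comm : ∀ X : C, (β_ X X).hom ≫ d X = d X

/-! ### LPC models -/

/-- A linear/producing/consuming model with linear category `(L, ⊗)`, producing category `(P, ⊗)`
and consuming category `(C, ⅋)`. The tensor of `C` is its cotensor. -/
structure LPCModel (L : Type u₁) [Category.{v₁} L] [MonoidalCategory L] [SymmetricCategory L]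
    (P : Type u₂) [Category.{v₂} P] [MonoidalCategory P] [SymmetricCategory P]
    (C : Type u₃) [Category.{v₃} C] [MonoidalCategory C] [SymmetricCategory C] where
  /-- the cotensor, the linear distribution and the negation of `L` -/
  lin : LinearDistributiveNeg L
  finiteProducts : Limits.HasFiniteProducts L
  finiteCoproducts : Limits.HasFiniteCoproducts L
  /-- the duality between `P` and `C` -/
  dual : SymMonoidalDuality P C
  /-- the comonoids of `P` -/
  comonoids : NaturalComonoids P
  /-- the monoids of `C` -/
  monoids : NaturalMonoids C
  /-- the comonoids and the monoids are interchanged under the duality -/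
  star_e : ∀ X : P,
    Functor.LaxMonoidal.ε dual.star ≫ dual.star.map (comonoids.e X).op =
      monoids.e (dual.star.obj (op X))
  star_d : ∀ X : P,
    Functor.LaxMonoidal.μ dual.star (op X) (op X) ≫ dual.star.map (comonoids.d X).op =
      monoids.d (dual.star.obj (op X))
  lowerStar_e : ∀ Y : C,
    dual.lowerStar.map (monoids.e Y).op ≫ Functor.OplaxMonoidal.η dual.lowerStar =
      comonoids.e (dual.lowerStar.obj (op Y))
  lowerStar_d : ∀ Y : C,
    dual.lowerStar.map (monoids.d Y).op ≫ Functor.OplaxMonoidal.δ dual.lowerStar (op Y) (op Y) =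
      comonoids.d (dual.lowerStar.obj (op Y))
  /-- the functor `⌈-⌉` -/
  bang : L ⥤ P
  /-- the functor `F_!` -/
  freeBang : P ⥤ L
  /-- the functor `⌊-⌋` -/
  whyNot : L ⥤ C
  /-- the functor `F_?` -/
  freeWhyNot : C ⥤ L
  /-- the symmetric monoidal adjunction `F_! ⊣ ⌈-⌉` between `(P, ⊗)` and `(L, ⊗)` -/
  producing : SymMonoidalAdjunction freeBang bang
  /-- the symmetric comonoidal adjunction `⌊-⌋ ⊣ F_?` between `(L, ⅋)` and `(C, ⅋)` -/
  consuming : @SymComonoidalAdjunction L _ lin.cot.mon lin.cot.symm C _ _ _ whyNot freeWhyNot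
  /-- the isomorphisms `(F_! X)^⊥ ≅ F_? (X^*)`, natural in `X` -/
  negFreeBang : ∀ X : P,
    lin.neg (freeBang.obj X) ≅ freeWhyNot.obj (dual.star.obj (op X))
  negFreeBang_naturality : ∀ {X Y : P} (f : X ⟶ Y),
    lin.negMap (freeBang.map f) ≫ (negFreeBang X).hom =
      (negFreeBang Y).hom ≫ freeWhyNot.map (dual.star.map f.op)
  /-- the isomorphisms `⌈A⌉^* ≅ ⌊A^⊥⌋`, natural in `A` -/
  starBang : ∀ A : L, dual.star.obj (op (bang.obj A)) ≅ whyNot.obj (lin.neg A)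
  starBang_naturality : ∀ {A B : L} (f : A ⟶ B),
    dual.star.map (bang.map f).op ≫ (starBang A).hom =
      (starBang B).hom ≫ whyNot.map (lin.negMap f)

/-! ### Models of classical linear logic -/

/-- A linear exponential comonad on a symmetric monoidal category: a symmetric monoidal comonad
with monoidal natural transformations `e_A : !A ⟶ 1` and `d_A : !A ⟶ !A ⊗ !A` such that
every `(!A, d_A, e_A)` is a commutative comonoid, `e_A` and `d_A` are morphisms of coalgebras, and
every morphism of coalgebras between free coalgebras is a morphism of comonoids. -/
structure LinearExponentialComonad (L : Type u) [Category.{v} L] [MonoidalCategory L]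
    [SymmetricCategory L] extends Comonad L where
  [lax : toFunctor.LaxBraided]
  counit_monoidal : NatTrans.IsMonoidal toComonad.ε
  comult_monoidal : NatTrans.IsMonoidal toComonad.δ
  e : ∀ A : L, obj A ⟶ 𝟙_ L
  d : ∀ A : L, obj A ⟶ obj A ⊗ obj A
  e_naturality : ∀ {A B : L} (f : A ⟶ B), map f ≫ e B = e A
  d_naturality : ∀ {A B : L} (f : A ⟶ B), map f ≫ d B = d A ≫ (map f ⊗ₘ map f)
  e_tensor : ∀ A B : L,
    Functor.LaxMonoidal.μ toFunctor A B ≫ e (A ⊗ B) = (e A ⊗ₘ e B) ≫ (λ_ (𝟙_ L)).hom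
  e_tensorUnit : Functor.LaxMonoidal.ε toFunctor ≫ e (𝟙_ L) = 𝟙 (𝟙_ L)
  d_tensor : ∀ A B : L,
    Functor.LaxMonoidal.μ toFunctor A B ≫ d (A ⊗ B) =
      (d A ⊗ₘ d B) ≫ tensorμ (obj A) (obj A) (obj B) (obj B) ≫
        (Functor.LaxMonoidal.μ toFunctor A B ⊗ₘ Functor.LaxMonoidal.μ toFunctor A B)
  d_tensorUnit :
    Functor.LaxMonoidal.ε toFunctor ≫ d (𝟙_ L) =
      (λ_ (𝟙_ L)).inv ≫ (Functor.LaxMonoidal.ε toFunctor ⊗ₘ Functor.LaxMonoidal.ε toFunctor)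
  counit_left : ∀ A : L, d A ≫ (e A ▷ obj A) = (λ_ (obj A)).inv
  counit_right : ∀ A : L, d A ≫ (obj A ◁ e A) = (ρ_ (obj A)).inv
  comonoid_coassoc : ∀ A : L,
    d A ≫ (d A ▷ obj A) ≫ (α_ (obj A) (obj A) (obj A)).hom = d A ≫ (obj A ◁ d A)
  cocomm : ∀ A : L, d A ≫ (β_ (obj A) (obj A)).hom = d A
  /-- `e_A` is a morphism of coalgebras -/
  e_coalgebra : ∀ A : L,
    toComonad.δ.app A ≫ map (e A) = e A ≫ Functor.LaxMonoidal.ε toFunctor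
  /-- `d_A` is a morphism of coalgebras -/
  d_coalgebra : ∀ A : L,
    toComonad.δ.app A ≫ map (d A) =
      d A ≫ (toComonad.δ.app A ⊗ₘ toComonad.δ.app A) ≫
        Functor.LaxMonoidal.μ toFunctor (obj A) (obj A)
  /-- morphisms of free coalgebras are morphisms of comonoids -/
  free_hom : ∀ {A B : L} (f : obj A ⟶ obj B),
    f ≫ toComonad.δ.app B = toComonad.δ.app A ≫ map f →
      f ≫ e B = e A ∧ f ≫ d B = d A ≫ (f ⊗ₘ f)

attribute [instance] LinearExponentialComonad.lax

/-- The canonical morphism `A ⟶ (A ⊸ B) ⊸ B` of a symmetric monoidal closed category. -/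
def toDoubleDual {L : Type u} [Category.{v} L] [MonoidalCategory L] [SymmetricCategory L]
    [MonoidalClosed L] (B A : L) : A ⟶ (ihom ((ihom A).obj B)).obj B :=
  MonoidalClosed.curry ((β_ ((ihom A).obj B) A).hom ≫ (ihom.ev A).app B)

/-- A model of classical linear logic on a symmetric monoidal category: it is *-autonomous (that is,
closed with a dualizing object), has finite products, and carries a linear exponential comonad. -/
structure ClassicalLinearModel (L : Type u) [Category.{v} L] [MonoidalCategory L]
    [SymmetricCategory L] where
  [closed : MonoidalClosed L]
  /-- the dualizing object -/
  dualizing : L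
  isIso_toDoubleDual : ∀ A : L, IsIso (toDoubleDual dualizing A)
  finiteProducts : Limits.HasFiniteProducts L
  bang : LinearExponentialComonad L

namespace LPCModel

variable {L : Type u₁} [Category.{v₁} L] [MonoidalCategory L] [SymmetricCategory L]
  {P : Type u₂} [Category.{v₂} P] [MonoidalCategory P] [SymmetricCategory P]
  {C : Type u₃} [Category.{v₃} C] [MonoidalCategory C] [SymmetricCategory C]

/-- The negation of the LPC model is the one of the *-autonomous category: up to isomorphism, `bot`
is the dualizing object `⊥`, `neg A` is `A ⊸ ⊥`, and `neg A ⊗ A ⟶ bot` is evaluation. -/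
def HasNegationOf (M : LPCModel L P C) (S : ClassicalLinearModel L) : Prop :=
  letI := S.closed
  ∃ b : M.lin.cot.bot ≅ S.dualizing, ∀ A : L,
    ∃ n : M.lin.neg A ≅ (ihom A).obj S.dualizing,
      M.lin.γbot A ≫ b.hom =
        (n.hom ▷ A) ≫ (β_ ((ihom A).obj S.dualizing) A).hom ≫ (ihom.ev A).app S.dualizing

/-- The adjunction `F_! ⊣ ⌈-⌉` decomposes the comonad `!`: there is an isomorphism
`F_! ⌈-⌉ ≅ !` of monoidal comonads that carries the comonoids `F_! ⌈A⌉`, induced by the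
comonoids of `P`, to the comonoids `!A`. -/
def Decomposes (M : LPCModel L P C) (E : LinearExponentialComonad L) : Prop :=
  letI := M.producing.leftLax
  letI := M.producing.rightLax
  ∃ θ : M.bang ⋙ M.freeBang ≅ E.toFunctor,
    (∀ A : L, θ.hom.app A ≫ E.toComonad.ε.app A = M.producing.adj.counit.app A) ∧
    (∀ A : L, θ.hom.app A ≫ E.toComonad.δ.app A =
      M.freeBang.map (M.producing.adj.unit.app (M.bang.obj A)) ≫
        θ.hom.app (M.freeBang.obj (M.bang.obj A)) ≫
        E.map (θ.hom.app A)) ∧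
    NatTrans.IsMonoidal θ.hom ∧
    (∀ A : L, M.freeBang.map (M.comonoids.e (M.bang.obj A)) =
      θ.hom.app A ≫ E.e A ≫ Functor.LaxMonoidal.ε M.freeBang) ∧
    (∀ A : L, M.freeBang.map (M.comonoids.d (M.bang.obj A)) =
      θ.hom.app A ≫ E.d A ≫ (θ.inv.app A ⊗ₘ θ.inv.app A) ≫
        Functor.LaxMonoidal.μ M.freeBang (M.bang.obj A)
          (M.bang.obj A))

end LPCModel

end LPC

/-! The producing category is the Eilenberg–Moore category of coalgebras for `!`, and the consuming
category is its opposite. Two independent points carry the argument.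

On the linear side, reflexivity makes `A ↦ A ⊸ ⊥` an equivalence between `L` and its opposite.
Transporting `⊗` along it gives the cotensor `(A^⊥ ⊗ B^⊥)^⊥` together with all its symmetric
monoidal coherence. To avoid chasing double duals, the Cockett–Seely laws are derived from a few
evaluation laws (`EvaluationCotensor`). A map into `A ⅋ C` is determined by its application to
`C^⊥`, and the distribution is defined by its application. Most coherence laws therefore reduce to
associators. The main exception is the mirrored distribution, which involves two symmetries of `⅋`
and is computed once, in `mirror_app`.

On the exponential side, the monoidal structure of `!` lifts `⊗` to coalgebras. A coaction `X ⟶ !X`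
is split by the counit of `!`, so the comonoid structure of `!X` restricts to `X`. By `coalgD_comp`
the coaction is compatible with the comultiplications, so the laws descend from `!X` to `X`. The key
input is that the comultiplication of the comonad is a map of cofree coalgebras, hence of comonoids
(`δ_e`, `δ_d`). The forgetful–cofree adjunction is symmetric monoidal and its comonad is `!` itself.
The consuming adjunction is its opposite composed with the duality of `L`. -/

namespace LPC

/-! ### Evaluation calculus for a cotensor -/

/-- A cotensor described by evaluation: `neg A` is a dual of `A` with respect to the pairing `ev`,
and `A ⅋ C` represents the morphisms `X ⊗ neg C ⟶ A`. -/
structure EvaluationCotensor (L : Type u) [Category.{v} L] [MonoidalCategory L]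
    [SymmetricCategory L] where
  cot : ParStructure L
  neg : L → L
  negMap : ∀ {A B : L}, (A ⟶ B) → (neg B ⟶ neg A)
  ev : ∀ A : L, A ⊗ neg A ⟶ cot.bot
  ev_ext : ∀ {X A : L} {f g : X ⟶ A}, (f ▷ neg A) ≫ ev A = (g ▷ neg A) ≫ ev A → f = g
  ev_ext' : ∀ {X A : L} {f g : X ⟶ neg A}, (A ◁ f) ≫ ev A = (A ◁ g) ≫ ev A → f = g
  lift : ∀ {X A : L}, (A ⊗ X ⟶ cot.bot) → (X ⟶ neg A)
  lift_ev : ∀ {X A : L} (h : A ⊗ X ⟶ cot.bot), (A ◁ lift h) ≫ ev A = h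
  negMap_ev : ∀ {A B : L} (f : A ⟶ B), (A ◁ negMap f) ≫ ev A = (f ▷ neg B) ≫ ev B
  dbl : ∀ A : L, neg (neg A) ⟶ A
  dbl_ev : ∀ A : L, (dbl A ▷ neg A) ≫ ev A = (β_ (neg (neg A)) (neg A)).hom ≫ ev (neg A)
  app : ∀ A C : L, cot.par A C ⊗ neg C ⟶ A
  app_ext : ∀ {X A C : L} {f g : X ⟶ cot.par A C},
    (f ▷ neg C) ≫ app A C = (g ▷ neg C) ≫ app A C → f = g
  abs : ∀ {X A C : L}, (X ⊗ neg C ⟶ A) → (X ⟶ cot.par A C)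
  abs_app : ∀ {X A C : L} (h : X ⊗ neg C ⟶ A), (abs h ▷ neg C) ≫ app A C = h
  parHom_app : ∀ {A A' C C' : L} (f : A ⟶ A') (g : C ⟶ C'),
    (cot.parHom f g ▷ neg C') ≫ app A' C' = (cot.par A C ◁ negMap g) ≫ app A C ≫ f
  -- The order is reversed because application consumes the last factor of a cotensor first.
  parNeg : ∀ B C : L, neg C ⊗ neg B ≅ neg (cot.par B C)
  parNeg_ev : ∀ B C : L, (cot.par B C ◁ (parNeg B C).hom) ≫ ev (cot.par B C) =
    (α_ _ _ _).inv ≫ (app B C ▷ neg B) ≫ ev B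
  assoc_app : ∀ A B C : L,
    ((cot.parAssoc A B C).hom ▷ (neg C ⊗ neg B)) ≫
      (cot.par A (cot.par B C) ◁ (parNeg B C).hom) ≫ app A (cot.par B C) =
    (α_ _ _ _).inv ≫ (app (cot.par A B) C ▷ neg B) ≫ app A B
  -- This plays the role of the identity functional on the unit of the cotensor: applying to it must
  -- give the right unitor.
  botNeg : 𝟙_ L ⟶ neg cot.bot
  botNeg_ev : (ρ_ cot.bot).inv ≫ (cot.bot ◁ botNeg) ≫ ev cot.bot = 𝟙 cot.bot
  parRight_app : ∀ A : L,
    (ρ_ (cot.par A cot.bot)).inv ≫ (cot.par A cot.bot ◁ botNeg) ≫ app A cot.bot =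
      (cot.parRight A).hom
  parLeft_app : ∀ C : L, ((cot.parLeft C).hom ▷ neg C) ≫ ev C = app cot.bot C
  -- `app A B` and `app B A` have different targets, so the symmetry can be compared with them only
  -- after both arguments are supplied.
  swap_app : ∀ A B : L,
    (((cot.parSwap A B).hom ▷ neg A) ≫ app B A) ▷ neg B ≫ ev B =
      (α_ _ _ _).hom ≫ (cot.par A B ◁ (β_ (neg A) (neg B)).hom) ≫ (α_ _ _ _).inv ≫
        (app A B ▷ neg A) ≫ ev A

namespace EvaluationCotensor

variable {L : Type u} [Category.{v} L] [MonoidalCategory L] [SymmetricCategory L]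
  (E : EvaluationCotensor L)

/-- As `parNeg` is invertible, maps into a nested cotensor may be tested on `C^⊥ ⊗ B^⊥`, the form in
which `assoc_app` describes the associator. -/
lemma assoc_ext {X A B C : L} {f g : X ⟶ E.cot.par A (E.cot.par B C)}
    (h : (X ◁ (E.parNeg B C).hom) ≫ (f ▷ _) ≫ E.app A (E.cot.par B C) =
      (X ◁ (E.parNeg B C).hom) ≫ (g ▷ _) ≫ E.app A (E.cot.par B C)) : f = g :=
  E.app_ext ((cancel_epi _).1 h)

/-! ### The linear distribution and its mirror image -/

/-- The linear distribution `A ⊗ (B ⅋ C) ⟶ (A ⊗ B) ⅋ C`. -/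
def dist (A B C : L) : A ⊗ E.cot.par B C ⟶ E.cot.par (A ⊗ B) C :=
  E.abs ((α_ _ _ _).hom ≫ (A ◁ E.app B C))

lemma dist_app (A B C : L) :
    (E.dist A B C ▷ E.neg C) ≫ E.app (A ⊗ B) C = (α_ _ _ _).hom ≫ (A ◁ E.app B C) :=
  E.abs_app _

/-- Partial application `B ⊗ (A ⊗ B)^⊥ ⟶ A^⊥`. -/
def kappa (A B : L) : B ⊗ E.neg (A ⊗ B) ⟶ E.neg A :=
  E.lift ((α_ _ _ _).inv ≫ E.ev (A ⊗ B))

lemma kappa_ev (A B : L) :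
    (A ◁ E.kappa A B) ≫ E.ev A = (α_ _ _ _).inv ≫ E.ev (A ⊗ B) :=
  E.lift_ev _

/-- `swap_app` at a generalized element of `B^⊥`; it removes the inner symmetry in `mirror_app`. -/
lemma swap_app_mid {A B X : L} (x : X ⟶ E.neg B) :
    ((((E.cot.parSwap A B).hom ▷ E.neg A) ≫ E.app B A) ⊗ₘ x) ≫ E.ev B =
      (α_ _ _ _).hom ≫ (E.cot.par A B ◁ (β_ (E.neg A) X).hom) ≫ (α_ _ _ _).inv ≫
        (((E.cot.par A B ◁ x) ≫ E.app A B) ▷ E.neg A) ≫ E.ev A := by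
  rw [tensorHom_def', Category.assoc, E.swap_app]
  simp only [tensor_whiskerLeft, Category.assoc, Iso.inv_hom_id_assoc, comp_whiskerRight,
    whisker_assoc]
  rw [← MonoidalCategory.whiskerLeft_comp_assoc, ← MonoidalCategory.whiskerLeft_comp_assoc,
    BraidedCategory.braiding_naturality_right]

lemma negMap_id (A : L) : E.negMap (𝟙 A) = 𝟙 _ :=
  E.ev_ext' (by rw [E.negMap_ev]; simp)

lemma parHom_id_app {A A' : L} (f : A ⟶ A') (C : L) :
    (E.cot.parHom f (𝟙 C) ▷ E.neg C) ≫ E.app A' C = E.app A C ≫ f := by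
  rw [E.parHom_app, E.negMap_id]; simp

lemma id_parHom_app (A : L) {C C' : L} (g : C ⟶ C') :
    (E.cot.parHom (𝟙 A) g ▷ E.neg C') ≫ E.app A C' =
      (E.cot.par A C ◁ E.negMap g) ≫ E.app A C := by
  rw [E.parHom_app]; simp

/-- `swap_app` at generalized elements of `A ⅋ B` and `A^⊥`; it removes the outer symmetry in
`mirror_app`. -/
lemma comp_swap_app {A B X Y : L} (m : X ⟶ E.cot.par A B) (n : Y ⟶ E.neg A) :
    (((m ≫ (E.cot.parSwap A B).hom) ▷ Y) ≫ (_ ◁ n) ≫ E.app B A) ▷ E.neg B ≫ E.ev B =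
      (α_ _ _ _).hom ≫ (X ◁ (β_ Y (E.neg B)).hom) ≫ (α_ _ _ _).inv ≫
        (((m ▷ E.neg B) ≫ E.app A B) ▷ Y) ≫ (A ◁ n) ≫ E.ev A := by
  have h : (((m ≫ (E.cot.parSwap A B).hom) ▷ Y) ≫ (_ ◁ n) ≫ E.app B A) ▷ E.neg B ≫ E.ev B =
      ((X ◁ n) ▷ E.neg B) ≫ ((m ▷ E.neg A) ▷ E.neg B) ≫
        (((E.cot.parSwap A B).hom ▷ E.neg A) ≫ E.app B A) ▷ E.neg B ≫ E.ev B := by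
    rw [← whisker_exchange_assoc]; simp
  rw [h, E.swap_app, ← whisker_exchange_assoc, tensor_whiskerLeft]
  simp only [Category.assoc, comp_whiskerRight, associator_naturality_left_assoc,
    ← whisker_exchange_assoc, associator_inv_naturality_left_assoc, Iso.inv_hom_id_assoc]
  simp only [whisker_assoc, Category.assoc, Iso.inv_hom_id_assoc,
    ← MonoidalCategory.whiskerLeft_comp_assoc, BraidedCategory.braiding_naturality_left]

/-- Applying the mirrored distribution to a functional on `B ⊗ C` amounts to feeding `C` to that
functional and applying `A ⅋ B` to the resulting functional on `B`. Evaluation against `A^⊥` makes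
the two symmetries of the cotensor computable, and what remains of them is a product of braidings
that cancel. -/
lemma mirror_app (A B C : L) :
    (E.cot.mirror E.dist A B C ▷ E.neg (B ⊗ C)) ≫ E.app A (B ⊗ C) =
      (α_ _ _ _).hom ≫ (E.cot.par A B ◁ E.kappa B C) ≫ E.app A B := by
  apply E.ev_ext
  -- The part of the mirror before its outer symmetry is applied to `A^⊥` first, which exposes
  -- `dist_app`; the inner symmetry is left in place for `hmid`.
  have hmid := E.swap_app_mid (A := A) (B := B) (E.kappa B C)
  have hin : (((β_ (E.cot.par A B) C).hom ≫ (C ◁ (E.cot.parSwap A B).hom) ≫ E.dist C B A) ▷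
      E.neg A) ≫ E.app (C ⊗ B) A ≫ (β_ C B).hom =
      (α_ _ _ _).hom ≫ (E.cot.par A B ◁ (β_ C (E.neg A)).hom) ≫ (α_ _ _ _).inv ≫
        (((E.cot.parSwap A B).hom ▷ E.neg A) ≫ E.app B A) ▷ C := by
    simp only [comp_whiskerRight, Category.assoc, reassoc_of% E.dist_app, whisker_assoc,
      Iso.inv_hom_id_assoc]
    rw [← MonoidalCategory.whiskerLeft_comp_assoc, BraidedCategory.braiding_naturality_right]
    simp
    rw [← comp_whiskerRight_assoc, SymmetricCategory.symmetry]
    simp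
  calc _ = (α_ _ _ _).hom ≫ (_ ◁ (β_ (E.neg (B ⊗ C)) (E.neg A)).hom) ≫ (α_ _ _ _).inv ≫
        ((((β_ (E.cot.par A B) C).hom ≫ (C ◁ (E.cot.parSwap A B).hom) ≫ E.dist C B A) ▷
      E.neg A) ≫ E.app (C ⊗ B) A ≫ (β_ C B).hom) ▷ E.neg (B ⊗ C) ≫ E.ev (B ⊗ C) := by
        have h := E.comp_swap_app ((β_ (E.cot.par A B) C).hom ≫
          (C ◁ (E.cot.parSwap A B).hom) ≫ E.dist C B A) (E.negMap (β_ C B).hom)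
        rw [ParStructure.mirror]
        simp only [comp_whiskerRight, Category.assoc, E.id_parHom_app, E.negMap_ev] at h ⊢
        exact h
    _ = (α_ _ _ _).hom ≫ (_ ◁ (β_ (E.neg (B ⊗ C)) (E.neg A)).hom) ≫ (α_ _ _ _).inv ≫
        ((α_ _ _ _).hom ≫ (E.cot.par A B ◁ (β_ C (E.neg A)).hom) ≫ (α_ _ _ _).inv) ▷ _ ≫
          (α_ _ _ _).hom ≫
          ((((E.cot.parSwap A B).hom ▷ E.neg A) ≫ E.app B A) ⊗ₘ E.kappa B C) ≫ E.ev B := by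
        rw [hin, MonoidalCategory.tensorHom_def]
        simp [E.kappa_ev]
    _ = _ := by
        rw [hmid]
        -- `A^⊥` is moved past `(B ⊗ C)^⊥` and `C` by the outer symmetry, and moved back by the
        -- inner one.
        have hs : (C ◁ (β_ (E.neg (B ⊗ C)) (E.neg A)).hom) ≫ (α_ _ _ _).inv ≫
            ((β_ C (E.neg A)).hom ▷ E.neg (B ⊗ C)) ≫ ((β_ (E.neg A) C).hom ▷ E.neg (B ⊗ C)) ≫
            (α_ _ _ _).hom ≫ (C ◁ (β_ (E.neg A) (E.neg (B ⊗ C))).hom) ≫ (α_ _ _ _).inv =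
              (α_ _ _ _).inv := by
          rw [← comp_whiskerRight_assoc, SymmetricCategory.symmetry]
          simp [← MonoidalCategory.whiskerLeft_comp_assoc]
        simp only [BraidedCategory.braiding_tensor_right_hom, comp_whiskerRight, whisker_assoc,
          tensor_whiskerLeft, Category.assoc, Iso.inv_hom_id_assoc,
          MonoidalCategory.whiskerLeft_comp]
        have := congrArg (fun t => E.cot.par A B ◁ t) hs
        simp only [MonoidalCategory.whiskerLeft_comp] at this
        simp [reassoc_of% this]

/-! ### The Cockett–Seely coherence conditions -/

theorem dist_naturality {A A' B B' C C' : L} (f : A ⟶ A') (g : B ⟶ B') (h : C ⟶ C') :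
    (f ⊗ₘ E.cot.parHom g h) ≫ E.dist A' B' C' =
      E.dist A B C ≫ E.cot.parHom (f ⊗ₘ g) h := by
  apply E.app_ext
  rw [comp_whiskerRight, Category.assoc, E.dist_app, comp_whiskerRight, Category.assoc,
    E.parHom_app, ← whisker_exchange_assoc, reassoc_of% E.dist_app A B C, tensorHom_def',
    tensorHom_def']
  simp only [comp_whiskerRight, whisker_assoc, Category.assoc, Iso.inv_hom_id_assoc,
    associator_naturality_left_assoc, tensor_whiskerLeft]
  rw [← whisker_exchange]
  simp only [← MonoidalCategory.whiskerLeft_comp_assoc, E.parHom_app]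

theorem dist_tensorUnit (A B : L) :
    E.dist (𝟙_ L) A B ≫ E.cot.parHom (λ_ A).hom (𝟙 B) = (λ_ (E.cot.par A B)).hom := by
  apply E.app_ext
  rw [comp_whiskerRight, Category.assoc, E.parHom_id_app]
  simp [reassoc_of% E.dist_app]

theorem dist_parUnit (A B : L) :
    E.dist A B E.cot.bot ≫ (E.cot.parRight (A ⊗ B)).hom = A ◁ (E.cot.parRight B).hom := by
  rw [← E.parRight_app, ← E.parRight_app, rightUnitor_inv_naturality_assoc,
    ← whisker_exchange_assoc, E.dist_app]
  simp

theorem dist_tensorAssoc (A B C D : L) :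
    E.dist (A ⊗ B) C D ≫ E.cot.parHom (α_ A B C).hom (𝟙 D) =
      (α_ A B (E.cot.par C D)).hom ≫ (A ◁ E.dist B C D) ≫ E.dist A (B ⊗ C) D := by
  apply E.app_ext
  simp only [comp_whiskerRight, Category.assoc, E.parHom_id_app, E.dist_app]
  simp only [reassoc_of% E.dist_app, whisker_assoc, Category.assoc, Iso.inv_hom_id_assoc,
    ← MonoidalCategory.whiskerLeft_comp, E.dist_app]
  simp

/-- Applied successively to `D^⊥` and `C^⊥`, both sides apply the cotensor factor and leave `A`
untouched, so they differ only by associators. -/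
theorem dist_parAssoc (A B C D : L) :
    (A ◁ (E.cot.parAssoc B C D).hom) ≫ E.dist A B (E.cot.par C D) =
      E.dist A (E.cot.par B C) D ≫ E.cot.parHom (E.dist A B C) (𝟙 D) ≫
        (E.cot.parAssoc (A ⊗ B) C D).hom := by
  apply E.assoc_ext
  simp only [comp_whiskerRight, Category.assoc, E.dist_app, whisker_assoc, Iso.inv_hom_id_assoc]
  simp only [whisker_exchange_assoc, E.assoc_app]
  simp only [tensor_whiskerLeft, Category.assoc, Iso.inv_hom_id_assoc]
  simp only [← MonoidalCategory.whiskerLeft_comp, whisker_exchange_assoc, E.assoc_app]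
  simp only [associator_inv_naturality_left_assoc, ← comp_whiskerRight_assoc,
    E.parHom_id_app, reassoc_of% E.dist_app A (E.cot.par B C) D]
  simp only [comp_whiskerRight, Category.assoc, E.dist_app, whisker_assoc, Iso.inv_hom_id_assoc]
  monoidal

theorem dist_mirror_tensor (A B C D : L) :
    (E.dist A B C ▷ D) ≫ E.cot.mirror E.dist (A ⊗ B) C D =
      (α_ A (E.cot.par B C) D).hom ≫
        (A ◁ E.cot.mirror E.dist B C D) ≫ E.dist A B (C ⊗ D) := by
  apply E.app_ext
  simp only [comp_whiskerRight, Category.assoc, E.dist_app, E.mirror_app]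
  simp only [whisker_assoc, Category.assoc, Iso.inv_hom_id_assoc,
    ← MonoidalCategory.whiskerLeft_comp, E.mirror_app]
  rw [associator_naturality_left_assoc, ← whisker_exchange_assoc, E.dist_app]
  monoidal

/-- Application turns each side into an application of `A ⅋ B` to a functional on `B`; `key`
identifies the two functionals. -/
theorem dist_mirror_par (A B C D : L) :
    E.dist (E.cot.par A B) C D ≫
        E.cot.parHom (E.cot.mirror E.dist A B C) (𝟙 D) ≫
        (E.cot.parAssoc A (B ⊗ C) D).hom =
      E.cot.mirror E.dist A B (E.cot.par C D) ≫ E.cot.parHom (𝟙 A) (E.dist B C D) := by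
  apply E.assoc_ext
  simp only [comp_whiskerRight, Category.assoc, E.id_parHom_app, whisker_exchange_assoc,
    E.assoc_app]
  simp only [← whisker_exchange_assoc, E.mirror_app]
  simp only [associator_inv_naturality_left_assoc, ← comp_whiskerRight_assoc,
    E.parHom_id_app, reassoc_of% E.dist_app (E.cot.par A B) C D]
  simp only [comp_whiskerRight, Category.assoc, E.mirror_app]
  -- The transposed form of `dist_app`: both functionals on `B` become equal once an element of `B`
  -- is supplied.
  have key : (E.cot.par C D ◁ (E.parNeg (B ⊗ C) D).hom) ≫
        (E.cot.par C D ◁ E.negMap (E.dist B C D)) ≫ E.kappa B (E.cot.par C D) =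
      (α_ _ _ _).inv ≫ (E.app C D ▷ E.neg (B ⊗ C)) ≫ E.kappa B C := by
    apply E.ev_ext'
    simp only [MonoidalCategory.whiskerLeft_comp, Category.assoc, E.kappa_ev]
    simp only [associator_inv_naturality_right_assoc, E.negMap_ev, whisker_exchange_assoc,
      E.parNeg_ev]
    simp only [associator_inv_naturality_left_assoc, ← comp_whiskerRight_assoc, E.dist_app]
    rw [associator_inv_naturality_middle_assoc]
    monoidal
  have := congrArg (fun t => (α_ _ _ _).hom ≫ (E.cot.par A B ◁ t) ≫ E.app A B) key
  simp only [MonoidalCategory.whiskerLeft_comp, Category.assoc] at this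
  simp only [tensor_whiskerLeft, Category.assoc, Iso.inv_hom_id_assoc, this]
  monoidal

/-! ### Negation and the triangle identities -/

/-- The coevaluation `1 ⟶ A ⅋ A^⊥`. -/
def coev (A : L) : 𝟙_ L ⟶ E.cot.par A (E.neg A) :=
  E.abs ((λ_ _).hom ≫ E.dbl A)

lemma coev_app (A : L) :
    (E.coev A ▷ E.neg (E.neg A)) ≫ E.app A (E.neg A) = (λ_ _).hom ≫ E.dbl A :=
  E.abs_app _

/-- The evaluation `A^⊥ ⊗ A ⟶ ⊥`. -/
def pairing (A : L) : E.neg A ⊗ A ⟶ E.cot.bot := (β_ _ _).hom ≫ E.ev A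

/-- Evaluated at `A^⊥⊥`, the coevaluation contributes `dbl`, and `dbl_ev` turns the pairing with a
double dual back into evaluation, up to a braiding that cancels. -/
theorem triangle_neg (A : L) :
    (ρ_ (E.neg A)).inv ≫ (E.neg A ◁ E.coev A) ≫ E.dist (E.neg A) A (E.neg A) ≫
      E.cot.parHom (E.pairing A) (𝟙 (E.neg A)) ≫ (E.cot.parLeft (E.neg A)).hom =
        𝟙 (E.neg A) := by
  apply E.ev_ext
  simp only [comp_whiskerRight, Category.assoc, E.parLeft_app, E.parHom_id_app,
    reassoc_of% E.dist_app, whisker_assoc, Iso.inv_hom_id_assoc]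
  rw [← MonoidalCategory.whiskerLeft_comp_assoc, E.coev_app, pairing,
    MonoidalCategory.whiskerLeft_comp_assoc,
    BraidedCategory.braiding_naturality_right_assoc, E.dbl_ev]
  simp

theorem triangle (A : L) :
    (λ_ A).inv ≫ (E.coev A ▷ A) ≫ E.cot.mirror E.dist A (E.neg A) A ≫
      E.cot.parHom (𝟙 A) (E.pairing A) ≫ (E.cot.parRight A).hom = 𝟙 A := by
  -- By `parRight_app`, removing the unit of the cotensor is application to `botNeg`. Pulled back
  -- along the pairing, this becomes the pairing viewed as a functional on `A^⊥ ⊗ A`, which `kappa`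
  -- then applies to `A`.
  have key : (λ_ A).inv ≫ (E.coev A ▷ A) ≫ E.cot.mirror E.dist A (E.neg A) A ≫
      E.cot.parHom (𝟙 A) (E.pairing A) ≫ (E.cot.parRight A).hom =
      (ρ_ A).inv ≫ (A ◁ (E.botNeg ≫ E.negMap (E.pairing A))) ≫ E.kappa (E.neg A) A ≫ E.dbl A := by
    simp only [← E.parRight_app, rightUnitor_inv_naturality_assoc, ← whisker_exchange_assoc,
      E.id_parHom_app, E.mirror_app]
    simp only [whisker_exchange_assoc]
    simp only [← whisker_exchange_assoc, associator_naturality_left_assoc, E.coev_app]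
    simp
  rw [key]
  apply E.ev_ext
  simp only [comp_whiskerRight, Category.assoc, E.dbl_ev]
  rw [BraidedCategory.braiding_naturality_left_assoc, E.kappa_ev]
  rw [BraidedCategory.braiding_naturality_left_assoc]
  rw [associator_inv_naturality_right_assoc, MonoidalCategory.whiskerLeft_comp_assoc, E.negMap_ev]
  have h : (E.cot.bot ◁ E.botNeg) ≫ E.ev E.cot.bot = (ρ_ _).hom := by
    rw [← Iso.inv_comp_eq_id]; exact E.botNeg_ev
  rw [whisker_exchange_assoc, h, rightUnitor_naturality, pairing,
    BraidedCategory.braiding_naturality_left_assoc]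
  simp

/-- The linearly distributive structure with negation of an evaluation cotensor. -/
def linearDistributiveNeg : LinearDistributiveNeg L where
  cot := E.cot
  dist := E.dist
  dist_naturality := E.dist_naturality
  dist_tensorUnit := E.dist_tensorUnit
  dist_parUnit := E.dist_parUnit
  dist_tensorAssoc := E.dist_tensorAssoc
  dist_parAssoc := E.dist_parAssoc
  dist_mirror_par := E.dist_mirror_par
  dist_mirror_tensor := E.dist_mirror_tensor
  neg := E.neg
  γbot := E.pairing
  γone := E.coev
  triangle := E.triangle
  triangle_neg := E.triangle_neg

/-- The action defined through coevaluation agrees with the given one: dinaturality of the pairing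
(`h`) moves `f` to the other side of the distribution (`h'`), and `triangle_neg` collapses the rest.
-/
theorem linearDistributiveNeg_negMap {A B : L} (f : A ⟶ B) :
    E.linearDistributiveNeg.negMap f = E.negMap f := by
  have h : (E.neg B ◁ f) ≫ E.pairing B = (E.negMap f ▷ A) ≫ E.pairing A := by
    rw [pairing, pairing, BraidedCategory.braiding_naturality_left_assoc, E.negMap_ev,
      BraidedCategory.braiding_naturality_right_assoc]
  have h' : (E.neg B ◁ E.cot.parHom f (𝟙 (E.neg A))) ≫ E.dist (E.neg B) B (E.neg A) ≫
      E.cot.parHom (E.pairing B) (𝟙 (E.neg A)) =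
      (E.negMap f ▷ _) ≫ E.dist (E.neg A) A (E.neg A) ≫
        E.cot.parHom (E.pairing A) (𝟙 (E.neg A)) := by
    apply E.app_ext
    simp only [comp_whiskerRight, Category.assoc, E.parHom_id_app, reassoc_of% E.dist_app,
      whisker_assoc, Iso.inv_hom_id_assoc, associator_naturality_left_assoc,
      ← MonoidalCategory.whiskerLeft_comp_assoc]
    rw [MonoidalCategory.whiskerLeft_comp_assoc, h, whisker_exchange_assoc]
  rw [LinearDistributiveNeg.negMap]
  dsimp only [linearDistributiveNeg]
  rw [reassoc_of% h', whisker_exchange_assoc, ← rightUnitor_inv_naturality_assoc, E.triangle_neg,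
    Category.comp_id]

end EvaluationCotensor

/-! ### Duality in a *-autonomous category -/

section StarAutonomous

variable {L : Type u} [Category.{v} L] [MonoidalCategory L]
  [MonoidalClosed L] (D : L)

/-- The contravariant functor `A ↦ A ⊸ D`. -/
def dualFunctor : Lᵒᵖ ⥤ L := MonoidalClosed.internalHom.flip.obj D

/-- The dual `A ⊸ D`. -/
abbrev dual (A : L) : L := (dualFunctor D).obj (op A)

/-- The action of the dual on morphisms. -/
abbrev dualMap {A B : L} (f : A ⟶ B) : dual D B ⟶ dual D A := (dualFunctor D).map f.op

/-- Evaluation `A ⊗ (A ⊸ D) ⟶ D`. -/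
def dualEv (A : L) : A ⊗ dual D A ⟶ D := (ihom.ev A).app D

/-- Transposition into the dual. -/
def dualLift {X A : L} (h : A ⊗ X ⟶ D) : X ⟶ dual D A := MonoidalClosed.curry h

lemma dualLift_ev {X A : L} (h : A ⊗ X ⟶ D) : (A ◁ dualLift D h) ≫ dualEv D A = h :=
  (MonoidalClosed.uncurry_eq (MonoidalClosed.curry h)).symm.trans
    (MonoidalClosed.uncurry_curry h)

variable {D}

lemma dual_ext {X A : L} {f g : X ⟶ dual D A}
    (h : (A ◁ f) ≫ dualEv D A = (A ◁ g) ≫ dualEv D A) : f = g := by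
  apply MonoidalClosed.uncurry_injective
  exact (MonoidalClosed.uncurry_eq f).trans (h.trans (MonoidalClosed.uncurry_eq g).symm)

variable (D)

lemma dualMap_ev {A B : L} (f : A ⟶ B) :
    (A ◁ dualMap D f) ≫ dualEv D A = (f ▷ dual D B) ≫ dualEv D B :=
  MonoidalClosed.id_tensor_pre_app_comp_ev f D

variable [SymmetricCategory L]

/-- The pairing `(A ⊸ D) ⊗ A ⟶ D`. -/
def dualPairing (A : L) : dual D A ⊗ A ⟶ D := (β_ _ _).hom ≫ dualEv D A

lemma dualMap_pairing {A B : L} (f : A ⟶ B) :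
    (dualMap D f ▷ A) ≫ dualPairing D A = (dual D B ◁ f) ≫ dualPairing D B := by
  rw [dualPairing, dualPairing, BraidedCategory.braiding_naturality_left_assoc, dualMap_ev,
    BraidedCategory.braiding_naturality_right_assoc]

variable [∀ A : L, IsIso (toDoubleDual D A)]

/-- Reflexivity `A ≅ (A ⊸ D) ⊸ D`. -/
noncomputable def bidual (A : L) : A ≅ dual D (dual D A) :=
  @asIso _ _ _ (dual D (dual D A)) (toDoubleDual D A) (‹∀ A : L, IsIso (toDoubleDual D A)› A)

lemma bidual_ev (A : L) :
    (dual D A ◁ (bidual D A).hom) ≫ dualEv D (dual D A) = dualPairing D A :=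
  dualLift_ev D _

/-- After evaluation, this is dinaturality of the pairing. -/
lemma bidual_naturality {A B : L} (f : A ⟶ B) :
    f ≫ (bidual D B).hom = (bidual D A).hom ≫ dualMap D (dualMap D f) := by
  apply dual_ext
  rw [MonoidalCategory.whiskerLeft_comp_assoc, bidual_ev,
    MonoidalCategory.whiskerLeft_comp_assoc, dualMap_ev, whisker_exchange_assoc, bidual_ev,
    dualMap_pairing]

/-- The triangle identity needed for `dualEquivalence`. -/
lemma bidual_dualMap (A : L) :
    (bidual D (dual D A)).hom ≫ dualMap D (bidual D A).hom = 𝟙 _ := by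
  apply dual_ext
  rw [MonoidalCategory.whiskerLeft_comp_assoc, dualMap_ev, whisker_exchange_assoc,
    bidual_ev, dualPairing, BraidedCategory.braiding_naturality_left_assoc, bidual_ev,
    dualPairing]
  simp

/-- The dual is an equivalence with the opposite category. -/
noncomputable def dualEquivalence : Lᵒᵖ ≌ L where
  functor := dualFunctor D
  inverse := (dualFunctor D).rightOp
  unitIso := NatIso.ofComponents (fun A => (bidual D (unop A)).symm.op)
    (fun {A B} f => Quiver.Hom.unop_inj (by
      have h := bidual_naturality D f.unop
      rw [← Iso.inv_comp_eq, ← Category.assoc, ← Iso.eq_comp_inv] at h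
      exact h))
  counitIso := NatIso.ofComponents (fun A => (bidual D A).symm)
    (fun {A B} f => by
      have h := bidual_naturality D f
      rw [← Iso.inv_comp_eq, ← Category.assoc, ← Iso.eq_comp_inv] at h
      exact h.symm)
  functor_unitIso_comp A := by
    have h := bidual_dualMap D (unop A)
    have h' : IsIso (dualMap D (bidual D (unop A)).hom) := inferInstance
    have : dualMap D (bidual D (unop A)).inv ≫ (bidual D (dual D (unop A))).inv = 𝟙 _ := by
      rw [Iso.comp_inv_eq, Category.id_comp, ← cancel_mono (dualMap D (bidual D (unop A)).hom), h,
        ← Functor.map_comp, ← op_comp, Iso.hom_inv_id, op_id, CategoryTheory.Functor.map_id]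
    exact this

/-- The cotensor `A ⅋ B = (A^⊥ ⊗ B^⊥)^⊥`. -/
noncomputable def dualCotensor : ParStructure L where
  mon := Monoidal.transport (dualEquivalence D)
  symm := Monoidal.Transported.instSymmetricCategory (dualEquivalence D)

end StarAutonomous

/-! ### Evaluation laws for the dual cotensor -/

section StarAutonomous

variable {L : Type u} [Category.{v} L] [MonoidalCategory L]
  [MonoidalClosed L] (D : L)

/-- `1 ⊸ D` is isomorphic to `D`. -/
def dualUnitIso : dual D (𝟙_ L) ≅ D where
  hom := (λ_ _).inv ≫ dualEv D (𝟙_ L)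
  inv := dualLift D (λ_ _).hom
  hom_inv_id := by
    apply dual_ext
    rw [MonoidalCategory.whiskerLeft_comp_assoc, dualLift_ev]
    simp
  inv_hom_id := by
    rw [leftUnitor_inv_naturality_assoc, dualLift_ev]
    simp

variable [SymmetricCategory L] [∀ A : L, IsIso (toDoubleDual D A)]

lemma bidual_hom_pairing {A X : L} (f : X ⟶ A) :
    (f ▷ dual D A) ≫ dualEv D A =
      (β_ _ _).hom ≫ (dual D A ◁ (f ≫ (bidual D A).hom)) ≫ dualEv D (dual D A) := by
  rw [MonoidalCategory.whiskerLeft_comp_assoc, bidual_ev, dualPairing,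
    BraidedCategory.braiding_naturality_right_assoc]
  simp

lemma bidual_inv_ev (A : L) :
    ((bidual D A).inv ▷ dual D A) ≫ dualEv D A = dualPairing D (dual D A) := by
  rw [bidual_hom_pairing, dualPairing]
  simp

variable {D} in

-- Reflexivity: a map into `A` is recovered from its composite into the double dual, where maps are
-- separated by evaluation.
lemma dual_ext_left {X A : L} {f g : X ⟶ A}
    (h : (f ▷ dual D A) ≫ dualEv D A = (g ▷ dual D A) ≫ dualEv D A) : f = g := by
  rw [bidual_hom_pairing, bidual_hom_pairing, cancel_epi] at h
  exact (cancel_mono _).1 (dual_ext h)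

/-- Transposition of `X ⊗ (A ⊸ D) ⟶ D`. -/
noncomputable def dualUnlift {X A : L} (h : X ⊗ dual D A ⟶ D) : X ⟶ A :=
  dualLift D ((β_ _ _).hom ≫ h) ≫ (bidual D A).inv

lemma dualUnlift_ev {X A : L} (h : X ⊗ dual D A ⟶ D) :
    (dualUnlift D h ▷ dual D A) ≫ dualEv D A = h := by
  rw [bidual_hom_pairing, dualUnlift, Category.assoc, Iso.inv_hom_id, Category.comp_id,
    dualLift_ev]
  simp

/-- The cotensor `A ⅋ B`. -/
abbrev dpar (A B : L) : L := dual D (dual D A ⊗ dual D B)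

/-- The application `(A ⅋ C) ⊗ C^⊥ ⟶ A`. -/
noncomputable def parApp (A C : L) : dpar D A C ⊗ dual D C ⟶ A :=
  dualUnlift D ((α_ _ _ _).hom ≫ (_ ◁ (β_ _ _).hom) ≫ dualPairing D (dual D A ⊗ dual D C))

lemma parApp_ev (A C : L) : (parApp D A C ▷ dual D A) ≫ dualEv D A =
    (α_ _ _ _).hom ≫ (_ ◁ (β_ _ _).hom) ≫ dualPairing D (dual D A ⊗ dual D C) :=
  dualUnlift_ev D _

lemma parApp_comp_ev {X A C : L} (f : X ⟶ dpar D A C) :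
    ((f ▷ dual D C) ≫ parApp D A C) ▷ dual D A ≫ dualEv D A =
    (α_ _ _ _).hom ≫ (_ ◁ (β_ _ _).hom) ≫ (f ▷ _) ≫ dualPairing D (dual D A ⊗ dual D C) := by
  rw [comp_whiskerRight_assoc, parApp_ev]
  simp only [associator_naturality_left_assoc, ← whisker_exchange_assoc]

omit [∀ A : L, IsIso (toDoubleDual D A)] in
lemma pairing_comp {X B : L} (f : X ⟶ dual D B) :
    (f ▷ B) ≫ dualPairing D B = (β_ _ _).hom ≫ (B ◁ f) ≫ dualEv D B := by
  rw [dualPairing, BraidedCategory.braiding_naturality_left_assoc]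

/-- Pairing the application with `A^⊥` recovers the pairing of `A ⅋ C` with `A^⊥ ⊗ C^⊥`, which
separates maps into that dual. -/
lemma parApp_ext {X A C : L} {f g : X ⟶ dpar D A C}
    (h : (f ▷ dual D C) ≫ parApp D A C = (g ▷ dual D C) ≫ parApp D A C) : f = g := by
  have h' := congrArg (fun t => (t ▷ dual D A) ≫ dualEv D A) h
  simp only [parApp_comp_ev, cancel_epi, pairing_comp] at h'
  exact dual_ext h'

/-- Abstraction of `X ⊗ C^⊥ ⟶ A`. -/
noncomputable def parAbs {X A C : L} (h : X ⊗ dual D C ⟶ A) : X ⟶ dpar D A C :=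
  dualLift D ((β_ _ _).hom ≫ (_ ◁ (β_ _ _).hom) ≫ (α_ _ _ _).inv ≫ (h ▷ dual D A) ≫ dualEv D A)

lemma parAbs_app {X A C : L} (h : X ⊗ dual D C ⟶ A) :
    (parAbs D h ▷ dual D C) ≫ parApp D A C = h := by
  apply dual_ext_left (D := D)
  rw [parApp_comp_ev, pairing_comp, parAbs, dualLift_ev, SymmetricCategory.symmetry_assoc,
    ← MonoidalCategory.whiskerLeft_comp_assoc, SymmetricCategory.symmetry]
  simp

lemma parHom_app {A A' C C' : L} (f : A ⟶ A') (g : C ⟶ C') :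
    (dualMap D (dualMap D f ⊗ₘ dualMap D g) ▷ dual D C') ≫ parApp D A' C' =
      (dpar D A C ◁ dualMap D g) ≫ parApp D A C ≫ f := by
  apply dual_ext_left (D := D)
  rw [parApp_comp_ev, dualMap_pairing, comp_whiskerRight_assoc, comp_whiskerRight_assoc,
    ← dualMap_ev, ← whisker_exchange_assoc, parApp_ev]
  simp only [MonoidalCategory.tensorHom_def, tensor_whiskerLeft, whisker_assoc,
    Category.assoc, Iso.inv_hom_id_assoc, ← MonoidalCategory.whiskerLeft_comp_assoc,
    BraidedCategory.braiding_naturality_right]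
  rw [BraidedCategory.braiding_naturality_left_assoc, whisker_exchange]

/-- `C^⊥ ⊗ B^⊥ ≅ (B ⅋ C)^⊥`. -/
noncomputable def parNeg (B C : L) : dual D C ⊗ dual D B ≅ dual D (dpar D B C) :=
  β_ _ _ ≪≫ bidual D (dual D B ⊗ dual D C)

lemma parNeg_ev (B C : L) : (dpar D B C ◁ (parNeg D B C).hom) ≫
    dualEv D (dpar D B C) =
    (α_ _ _ _).inv ≫ (parApp D B C ▷ dual D B) ≫ dualEv D B := by
  rw [parApp_ev, parNeg, Iso.trans_hom, MonoidalCategory.whiskerLeft_comp_assoc]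
  rw [bidual_ev]
  simp

/-- The dualized composite is the associator of the transported structure written out. Paired with
`A^⊥`, its two double-dual isomorphisms meet those coming from `parNeg` and from the pairing of `A ⅋
B`, and `key` cancels them. -/
lemma assoc_app (A B C : L) :
    (dualMap D (((dual D A ◁ (bidual D (dual D B ⊗ dual D C)).inv) ≫ (α_ _ _ _).inv) ≫
        ((bidual D (dual D A ⊗ dual D B)).hom ▷ dual D C)) ▷ (dual D C ⊗ dual D B)) ≫
      (dpar D A (dpar D B C) ◁ (parNeg D B C).hom) ≫
        parApp D A (dpar D B C) =
    (α_ _ _ _).inv ≫ (parApp D (dpar D A B) C ▷ dual D B) ≫ parApp D A B := by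
  apply dual_ext_left (D := D)
  have h1 := parApp_comp_ev D (dualMap D (((dual D A ◁ (bidual D (dual D B ⊗ dual D C)).inv) ≫
    (α_ _ _ _).inv) ≫ ((bidual D (dual D A ⊗ dual D B)).hom ▷ dual D C)))
  have h2 := parApp_ev D (dpar D A B) C
  rw [dualMap_pairing] at h1
  rw [← whisker_exchange_assoc, comp_whiskerRight_assoc, h1]
  simp only [comp_whiskerRight, Category.assoc, parApp_ev D A B]
  rw [associator_naturality_left_assoc, ← whisker_exchange_assoc,
    ← bidual_ev D (dual D A ⊗ dual D B),
    ← whisker_exchange_assoc, h2]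
  have key : ((β_ (dual D C) (dual D B)).hom ▷ dual D A) ≫
      ((bidual D (dual D B ⊗ dual D C)).hom ▷ dual D A) ≫ (β_ _ (dual D A)).hom ≫
      (dual D A ◁ (bidual D (dual D B ⊗ dual D C)).inv) ≫ (α_ _ _ _).inv ≫
      ((bidual D (dual D A ⊗ dual D B)).hom ▷ dual D C) =
      (α_ _ _ _).hom ≫ (dual D C ◁ (β_ (dual D B) (dual D A)).hom) ≫
      (dual D C ◁ (bidual D (dual D A ⊗ dual D B)).hom) ≫ (β_ _ _).hom := by
    rw [BraidedCategory.braiding_naturality_left_assoc, whiskerLeft_hom_inv_assoc,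
      BraidedCategory.braiding_naturality_right, BraidedCategory.braiding_naturality_right_assoc]
    simp
  have key' := congrArg (fun t => dpar D (dpar D A B) C ◁ t) key
  simp only [MonoidalCategory.whiskerLeft_comp] at key'
  simp only [parNeg, Iso.trans_hom, MonoidalCategory.whiskerLeft_comp, comp_whiskerRight,
    whisker_assoc, Category.assoc, Iso.inv_hom_id_assoc, reassoc_of% key', tensor_whiskerLeft]
  simp

/-- The element `1 ⟶ ⊥^⊥`. -/
noncomputable def botNeg : 𝟙_ L ⟶ dual D (dual D (𝟙_ L)) := (bidual D (𝟙_ L)).hom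

omit [∀ A : L, IsIso (toDoubleDual D A)] in
lemma dualUnitIso_hom_eq : (dualUnitIso D).hom = (ρ_ _).inv ≫ dualPairing D (𝟙_ L) := by
  simp [dualPairing, dualUnitIso]

lemma botNeg_ev : (ρ_ _).inv ≫ (dual D (𝟙_ L) ◁ botNeg D) ≫
    dualEv D (dual D (𝟙_ L)) ≫ (dualUnitIso D).inv = 𝟙 (dual D (𝟙_ L)) := by
  rw [botNeg, reassoc_of% bidual_ev D (𝟙_ L), ← Category.assoc,
    ← dualUnitIso_hom_eq, Iso.hom_inv_id]

lemma parRight_app (A : L) :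
    (ρ_ (dpar D A (dual D (𝟙_ L)))).inv ≫
      (dpar D A (dual D (𝟙_ L)) ◁ botNeg D) ≫ parApp D A (dual D (𝟙_ L)) =
      dualMap D ((ρ_ _).inv ≫ (dual D A ◁ (bidual D (𝟙_ L)).hom)) ≫ (bidual D A).inv := by
  apply dual_ext_left (D := D)
  rw [comp_whiskerRight_assoc, comp_whiskerRight_assoc, comp_whiskerRight_assoc, bidual_inv_ev,
    dualMap_pairing, parApp_ev, botNeg]
  simp only [whisker_assoc, Category.assoc, Iso.inv_hom_id_assoc,
    ← MonoidalCategory.whiskerLeft_comp_assoc, BraidedCategory.braiding_naturality_left]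
  simp

lemma parLeft_app (C : L) :
    ((dualMap D ((λ_ _).inv ≫ ((bidual D (𝟙_ L)).hom ▷ dual D C)) ≫
      (bidual D C).inv) ▷ dual D C) ≫ dualEv D C =
    parApp D (dual D (𝟙_ L)) C ≫ (dualUnitIso D).hom := by
  rw [comp_whiskerRight_assoc, bidual_inv_ev, dualMap_pairing, dualUnitIso_hom_eq,
    rightUnitor_inv_naturality_assoc, ← bidual_ev D (𝟙_ L),
    ← whisker_exchange_assoc, parApp_ev, tensor_whiskerLeft]
  simp only [Category.assoc, Iso.inv_hom_id_assoc,
    ← MonoidalCategory.whiskerLeft_comp_assoc, BraidedCategory.braiding_naturality_right]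
  simp

lemma swap_app (A B : L) :
    ((dualMap D (β_ (dual D B) (dual D A)).hom ▷ dual D A) ≫ parApp D B A) ▷ dual D B ≫ dualEv D B =
      (α_ _ _ _).hom ≫ (dpar D A B ◁ (β_ (dual D A) (dual D B)).hom) ≫
        (α_ _ _ _).inv ≫ (parApp D A B ▷ dual D A) ≫ dualEv D A := by
  rw [parApp_comp_ev, dualMap_pairing, parApp_ev]
  simp [← MonoidalCategory.whiskerLeft_comp_assoc]

omit [SymmetricCategory L] [∀ A : L, IsIso (toDoubleDual D A)] in
lemma dualLift_unit_ev {A X : L} (h : A ⊗ X ⟶ dual D (𝟙_ L)) :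
    (A ◁ dualLift D (h ≫ (dualUnitIso D).hom)) ≫ dualEv D A ≫ (dualUnitIso D).inv = h := by
  rw [reassoc_of% dualLift_ev, Category.assoc, Iso.hom_inv_id, Category.comp_id]

/-- The cotensor of a *-autonomous category, described by evaluation. -/
noncomputable def dualEvaluationCotensor : EvaluationCotensor L where
  cot := dualCotensor D
  neg A := dual D A
  negMap f := dualMap D f
  -- The transported unit is `1 ⊸ D`, only isomorphic to `D`, so evaluation has to be corrected by
  -- `dualUnitIso`.
  ev A := dualEv D A ≫ (dualUnitIso D).inv
  ev_ext h := dual_ext_left (D := D) ((cancel_mono (dualUnitIso D).inv).1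
    ((Category.assoc _ _ _).trans (h.trans (Category.assoc _ _ _).symm)))
  ev_ext' h := dual_ext (D := D) ((cancel_mono (dualUnitIso D).inv).1
    ((Category.assoc _ _ _).trans (h.trans (Category.assoc _ _ _).symm)))
  lift h := dualLift D (h ≫ (dualUnitIso D).hom)
  lift_ev h := dualLift_unit_ev D h
  negMap_ev f := by
    have := congrArg (fun t => t ≫ (dualUnitIso D).inv) (dualMap_ev D f)
    simp only [Category.assoc] at this
    exact this
  dbl A := (bidual D A).inv
  dbl_ev A := by
    have := congrArg (fun t => t ≫ (dualUnitIso D).inv) (bidual_inv_ev D A)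
    simp only [dualPairing, Category.assoc] at this
    exact this
  app A C := parApp D A C
  app_ext h := parApp_ext D h
  abs h := parAbs D h
  abs_app h := parAbs_app D h
  parHom_app := parHom_app D
  parNeg B C := parNeg D B C
  parNeg_ev B C := by
    have := congrArg (fun t => t ≫ (dualUnitIso D).inv) (parNeg_ev D B C)
    simp only [Category.assoc] at this
    exact this
  assoc_app := assoc_app D
  botNeg := botNeg D
  botNeg_ev := botNeg_ev D
  parRight_app := parRight_app D
  parLeft_app C := by
    have := congrArg (fun t => t ≫ (dualUnitIso D).inv) (parLeft_app D C)
    simp only [Category.assoc, Iso.hom_inv_id, Category.comp_id] at this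
    exact this
  swap_app A B := by
    have := congrArg (fun t => t ≫ (dualUnitIso D).inv) (swap_app D A B)
    simp only [Category.assoc] at this
    exact this

end StarAutonomous

/-! ### The symmetric monoidal category of coalgebras -/

namespace LinearExponentialComonad

variable {L : Type u} [Category.{v} L] [MonoidalCategory L] [SymmetricCategory L]
  (E : LinearExponentialComonad L)

open Functor.LaxMonoidal

lemma ε_counit : ε E.toFunctor ≫ E.toComonad.ε.app (𝟙_ L) = 𝟙 _ :=
  E.counit_monoidal.unit

lemma μ_counit (A B : L) : μ E.toFunctor A B ≫ E.toComonad.ε.app (A ⊗ B) =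
    (E.toComonad.ε.app A ⊗ₘ E.toComonad.ε.app B) :=
  (E.counit_monoidal.tensor A B).trans (Category.comp_id _)

lemma ε_comult : ε E.toFunctor ≫ E.toComonad.δ.app (𝟙_ L) =
    ε E.toFunctor ≫ E.map (ε E.toFunctor) :=
  E.comult_monoidal.unit

lemma μ_comult (A B : L) : μ E.toFunctor A B ≫ E.toComonad.δ.app (A ⊗ B) =
    (E.toComonad.δ.app A ⊗ₘ E.toComonad.δ.app B) ≫ μ E.toFunctor (E.obj A) (E.obj B) ≫
      E.map (μ E.toFunctor A B) :=
  E.comult_monoidal.tensor A B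

/-- Coassociativity says that the comultiplication is a coalgebra map between free coalgebras, so
`free_hom` applies to it. -/
lemma δ_e (A : L) : E.toComonad.δ.app A ≫ E.e (E.obj A) = E.e A :=
  (E.free_hom (E.toComonad.δ.app A) (E.toComonad.coassoc A).symm).1

lemma δ_d (A : L) : E.toComonad.δ.app A ≫ E.d (E.obj A) =
    E.d A ≫ (E.toComonad.δ.app A ⊗ₘ E.toComonad.δ.app A) :=
  (E.free_hom (E.toComonad.δ.app A) (E.toComonad.coassoc A).symm).2

/-- The category of coalgebras. -/
abbrev Coalg := Comonad.Coalgebra E.toComonad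

variable {E}

lemma coalg_coassoc (X : Coalg E) : X.a ≫ E.toComonad.δ.app X.A = X.a ≫ E.map X.a := X.coassoc

lemma coalg_counit (X : Coalg E) : X.a ≫ E.toComonad.ε.app X.A = 𝟙 _ := X.counit

lemma hom_comm {X Y : Coalg E} (f : X ⟶ Y) : X.a ≫ E.map f.f = f.f ≫ Y.a := f.h

/-- The tensor of coalgebras. -/
def coalgTensor (X Y : Coalg E) : Coalg E where
  A := X.A ⊗ Y.A
  a := (X.a ⊗ₘ Y.a) ≫ μ E.toFunctor X.A Y.A
  counit := by
    rw [Category.assoc, μ_counit, tensorHom_comp_tensorHom, coalg_counit, coalg_counit]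
    simp
  coassoc := by
    rw [Category.assoc, μ_comult, tensorHom_comp_tensorHom_assoc, coalg_coassoc, coalg_coassoc,
      ← tensorHom_comp_tensorHom_assoc]
    simp

/-- The unit coalgebra. -/
def coalgUnit : Coalg E where
  A := 𝟙_ L
  a := ε E.toFunctor
  counit := E.ε_counit
  coassoc := E.ε_comult

/-- The tensor of morphisms of coalgebras. -/
def coalgTensorHom {X X' Y Y' : Coalg E} (f : X ⟶ X') (g : Y ⟶ Y') :
    coalgTensor X Y ⟶ coalgTensor X' Y' where
  f := f.f ⊗ₘ g.f
  h := by
    simp only [coalgTensor, Category.assoc, tensorHom_comp_tensorHom_assoc]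
    rw [← hom_comm, ← hom_comm, ← tensorHom_comp_tensorHom_assoc]
    simp

lemma coalg_associator (X Y Z : Coalg E) :
    (coalgTensor (coalgTensor X Y) Z).a ≫ E.map (α_ X.A Y.A Z.A).hom =
      (α_ X.A Y.A Z.A).hom ≫ (coalgTensor X (coalgTensor Y Z)).a := by
  have h1 : ((X.a ⊗ₘ Y.a) ≫ μ E.toFunctor X.A Y.A) ⊗ₘ Z.a =
      ((X.a ⊗ₘ Y.a) ⊗ₘ Z.a) ≫ (μ E.toFunctor X.A Y.A ▷ E.obj Z.A) := by
    rw [← tensorHom_id, tensorHom_comp_tensorHom, Category.comp_id]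
  have h2 : X.a ⊗ₘ ((Y.a ⊗ₘ Z.a) ≫ μ E.toFunctor Y.A Z.A) =
      (X.a ⊗ₘ (Y.a ⊗ₘ Z.a)) ≫ (E.obj X.A ◁ μ E.toFunctor Y.A Z.A) := by
    rw [← id_tensorHom, tensorHom_comp_tensorHom, Category.comp_id]
  change ((((X.a ⊗ₘ Y.a) ≫ μ E.toFunctor X.A Y.A) ⊗ₘ Z.a) ≫ μ E.toFunctor (X.A ⊗ Y.A) Z.A) ≫
      E.map (α_ X.A Y.A Z.A).hom = (α_ X.A Y.A Z.A).hom ≫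
    (X.a ⊗ₘ ((Y.a ⊗ₘ Z.a) ≫ μ E.toFunctor Y.A Z.A)) ≫ μ E.toFunctor X.A (Y.A ⊗ Z.A)
  rw [h1, h2, Category.assoc, Category.assoc, associativity, associator_naturality_assoc,
    Category.assoc]

lemma coalg_leftUnitor (X : Coalg E) :
    (coalgTensor coalgUnit X).a ≫ E.map (λ_ X.A).hom = (λ_ X.A).hom ≫ X.a := by
  change ((ε E.toFunctor ⊗ₘ X.a) ≫ μ E.toFunctor (𝟙_ L) X.A) ≫ E.map (λ_ X.A).hom = _
  rw [MonoidalCategory.tensorHom_def', Category.assoc, Category.assoc, ← left_unitality,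
    leftUnitor_naturality]

lemma coalg_rightUnitor (X : Coalg E) :
    (coalgTensor X coalgUnit).a ≫ E.map (ρ_ X.A).hom = (ρ_ X.A).hom ≫ X.a := by
  change ((X.a ⊗ₘ ε E.toFunctor) ≫ μ E.toFunctor X.A (𝟙_ L)) ≫ E.map (ρ_ X.A).hom = _
  rw [MonoidalCategory.tensorHom_def, Category.assoc, Category.assoc, ← right_unitality,
    rightUnitor_naturality]

lemma coalg_braiding (X Y : Coalg E) :
    (coalgTensor X Y).a ≫ E.map (β_ X.A Y.A).hom = (β_ X.A Y.A).hom ≫ (coalgTensor Y X).a := by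
  change ((X.a ⊗ₘ Y.a) ≫ μ E.toFunctor X.A Y.A) ≫ E.map (β_ X.A Y.A).hom =
    (β_ X.A Y.A).hom ≫ (Y.a ⊗ₘ X.a) ≫ μ E.toFunctor Y.A X.A
  rw [← BraidedCategory.braiding_naturality_assoc, Category.assoc,
    ← Functor.LaxBraided.braided]

instance : MonoidalCategory (Coalg E) where
  tensorObj := coalgTensor
  tensorUnit := coalgUnit
  tensorHom := coalgTensorHom
  whiskerLeft X _ _ f := coalgTensorHom (𝟙 X) f
  whiskerRight f X := coalgTensorHom f (𝟙 X)
  associator X Y Z := Comonad.Coalgebra.isoMk (α_ X.A Y.A Z.A) (coalg_associator X Y Z)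
  leftUnitor X := Comonad.Coalgebra.isoMk (λ_ X.A) (coalg_leftUnitor X)
  rightUnitor X := Comonad.Coalgebra.isoMk (ρ_ X.A) (coalg_rightUnitor X)
  tensorHom_def f g := Comonad.Coalgebra.Hom.ext (by
    simp only [coalgTensorHom, MonoidalCategory.tensorHom_def, Comonad.Coalgebra.id_f,
      Comonad.Coalgebra.comp_f, MonoidalCategory.whiskerLeft_id, id_whiskerRight,
      Category.comp_id, Category.id_comp]
    rfl)
  id_tensorHom_id X Y := Comonad.Coalgebra.Hom.ext (id_tensorHom_id X.A Y.A)
  tensorHom_comp_tensorHom f₁ f₂ g₁ g₂ :=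
    Comonad.Coalgebra.Hom.ext (tensorHom_comp_tensorHom f₁.f f₂.f g₁.f g₂.f)
  whiskerLeft_id X Y := Comonad.Coalgebra.Hom.ext (id_tensorHom_id X.A Y.A)
  id_whiskerRight X Y := Comonad.Coalgebra.Hom.ext (id_tensorHom_id X.A Y.A)
  associator_naturality f g h :=
    Comonad.Coalgebra.Hom.ext (associator_naturality f.f g.f h.f)
  leftUnitor_naturality {X Y} f := Comonad.Coalgebra.Hom.ext
    ((congrArg (· ≫ (λ_ Y.A).hom) (id_tensorHom (𝟙_ L) f.f)).trans (leftUnitor_naturality f.f))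
  rightUnitor_naturality {X Y} f := Comonad.Coalgebra.Hom.ext
    ((congrArg (· ≫ (ρ_ Y.A).hom) (tensorHom_id f.f (𝟙_ L))).trans (rightUnitor_naturality f.f))
  pentagon W X Y Z := Comonad.Coalgebra.Hom.ext (by
    have := pentagon W.A X.A Y.A Z.A
    rw [← tensorHom_id, ← id_tensorHom] at this
    exact this)
  triangle X Y := Comonad.Coalgebra.Hom.ext (by
    have := triangle X.A Y.A
    rw [← tensorHom_id, ← id_tensorHom] at this
    exact this)

lemma whiskerLeft_f (X : Coalg E) {Y Z : Coalg E} (f : Y ⟶ Z) : (X ◁ f).f = X.A ◁ f.f :=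
  id_tensorHom X.A f.f

lemma whiskerRight_f {Y Z : Coalg E} (f : Y ⟶ Z) (X : Coalg E) : (f ▷ X).f = f.f ▷ X.A :=
  tensorHom_id f.f X.A

lemma tensorHom_f {X X' Y Y' : Coalg E} (f : X ⟶ X') (g : Y ⟶ Y') :
    (f ⊗ₘ g).f = f.f ⊗ₘ g.f := rfl

instance : SymmetricCategory (Coalg E) where
  braiding X Y := Comonad.Coalgebra.isoMk (β_ X.A Y.A) (coalg_braiding X Y)
  braiding_naturality_right X _ _ f := Comonad.Coalgebra.Hom.ext (by
    rw [Comonad.Coalgebra.comp_f, Comonad.Coalgebra.comp_f, whiskerLeft_f, whiskerRight_f]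
    exact BraidedCategory.braiding_naturality_right X.A f.f)
  braiding_naturality_left f X := Comonad.Coalgebra.Hom.ext (by
    rw [Comonad.Coalgebra.comp_f, Comonad.Coalgebra.comp_f, whiskerLeft_f, whiskerRight_f]
    exact BraidedCategory.braiding_naturality_left f.f X.A)
  hexagon_forward X Y Z := Comonad.Coalgebra.Hom.ext (by
    simp only [Comonad.Coalgebra.comp_f, whiskerLeft_f, whiskerRight_f]
    exact BraidedCategory.hexagon_forward X.A Y.A Z.A)
  hexagon_reverse X Y Z := Comonad.Coalgebra.Hom.ext (by
    simp only [Comonad.Coalgebra.comp_f, whiskerLeft_f, whiskerRight_f]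
    exact BraidedCategory.hexagon_reverse X.A Y.A Z.A)
  symmetry X Y := Comonad.Coalgebra.Hom.ext (SymmetricCategory.symmetry X.A Y.A)

lemma tensorμ_f (X Y Z W : Coalg E) : (tensorμ X Y Z W).f = tensorμ X.A Y.A Z.A W.A := by
  simp only [tensorμ, Comonad.Coalgebra.comp_f, whiskerLeft_f, whiskerRight_f]
  rfl

/-! ### Comonoids carried by coalgebras -/

/-- The counit of the comonoid carried by a coalgebra. -/
def coalgE (X : Coalg E) : X.A ⟶ 𝟙_ L := X.a ≫ E.e X.A

/-- The comultiplication of the comonoid carried by a coalgebra. -/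
def coalgD (X : Coalg E) : X.A ⟶ X.A ⊗ X.A :=
  X.a ≫ E.d X.A ≫ (E.toComonad.ε.app X.A ⊗ₘ E.toComonad.ε.app X.A)

/-- The coaction respects comultiplications. Naturality turns counit followed by coaction into `!`
of the coaction followed by the counit. The former passes back through `d`, coassociativity replaces
it by the comultiplication of `!`, which passes through `d` by `δ_d` and cancels against the counit.
-/
lemma coalgD_comp (X : Coalg E) : coalgD X ≫ (X.a ⊗ₘ X.a) = X.a ≫ E.d X.A := by
  have hn : E.toComonad.ε.app X.A ≫ X.a = E.map X.a ≫ E.toComonad.ε.app (E.obj X.A) :=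
    (E.toComonad.ε.naturality X.a).symm
  have hc : E.toComonad.δ.app X.A ≫ E.toComonad.ε.app (E.obj X.A) = 𝟙 _ :=
    E.toComonad.left_counit X.A
  rw [coalgD, Category.assoc, Category.assoc, tensorHom_comp_tensorHom, hn,
    ← tensorHom_comp_tensorHom, ← reassoc_of% E.d_naturality X.a, ← reassoc_of% coalg_coassoc X,
    reassoc_of% E.δ_d X.A, tensorHom_comp_tensorHom, hc, id_tensorHom_id, Category.comp_id]

lemma coalgE_naturality {X Y : Coalg E} (f : X ⟶ Y) : f.f ≫ coalgE Y = coalgE X := by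
  rw [coalgE, ← reassoc_of% hom_comm f, E.e_naturality, coalgE]

lemma coalgD_naturality {X Y : Coalg E} (f : X ⟶ Y) :
    f.f ≫ coalgD Y = coalgD X ≫ (f.f ⊗ₘ f.f) := by
  have hn : E.map f.f ≫ E.toComonad.ε.app Y.A = E.toComonad.ε.app X.A ≫ f.f :=
    E.toComonad.ε.naturality f.f
  rw [coalgD, ← reassoc_of% hom_comm f, reassoc_of% E.d_naturality f.f, coalgD,
    tensorHom_comp_tensorHom, hn, ← tensorHom_comp_tensorHom]
  simp only [Category.assoc]

lemma coalgE_hom (X : Coalg E) : X.a ≫ E.map (coalgE X) = coalgE X ≫ ε E.toFunctor := by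
  rw [coalgE, Functor.map_comp, ← reassoc_of% coalg_coassoc X, E.e_coalgebra, Category.assoc]

lemma coalgD_hom (X : Coalg E) :
    X.a ≫ E.map (coalgD X) = coalgD X ≫ (X.a ⊗ₘ X.a) ≫ μ E.toFunctor X.A X.A := by
  have hc : E.toComonad.δ.app X.A ≫ E.map (E.toComonad.ε.app X.A) = 𝟙 _ :=
    E.toComonad.right_counit X.A
  rw [reassoc_of% coalgD_comp X, coalgD, Functor.map_comp, Functor.map_comp,
    ← reassoc_of% coalg_coassoc X, reassoc_of% E.d_coalgebra, ← μ_natural,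
    tensorHom_comp_tensorHom_assoc, hc, id_tensorHom_id, Category.id_comp]

/-- A tensor power of a split monomorphism is split, so coassociativity can be checked in the cofree
coalgebra. -/
lemma coalg_mono (X : Coalg E) {Y : L} {f g : Y ⟶ X.A ⊗ X.A ⊗ X.A}
    (h : f ≫ (X.a ⊗ₘ X.a ⊗ₘ X.a) = g ≫ (X.a ⊗ₘ X.a ⊗ₘ X.a)) : f = g := by
  have := congrArg (fun t => t ≫ (E.toComonad.ε.app X.A ⊗ₘ E.toComonad.ε.app X.A ⊗ₘ
    E.toComonad.ε.app X.A)) h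
  simpa only [Category.assoc, tensorHom_comp_tensorHom, coalg_counit, id_tensorHom_id,
    Category.comp_id] using this

/-- The natural comonoids of the category of coalgebras. -/
def coalgComonoids : NaturalComonoids (Coalg E) where
  e X := { f := coalgE X, h := coalgE_hom X }
  d X := { f := coalgD X, h := coalgD_hom X }
  e_naturality f := Comonad.Coalgebra.Hom.ext (coalgE_naturality f)
  d_naturality f := Comonad.Coalgebra.Hom.ext (coalgD_naturality f)
  e_tensor X Y := Comonad.Coalgebra.Hom.ext (by
    change ((X.a ⊗ₘ Y.a) ≫ μ E.toFunctor X.A Y.A) ≫ E.e (X.A ⊗ Y.A) =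
      (X.a ≫ E.e X.A ⊗ₘ Y.a ≫ E.e Y.A) ≫ (λ_ (𝟙_ L)).hom
    rw [Category.assoc, E.e_tensor, tensorHom_comp_tensorHom_assoc])
  e_tensorUnit := Comonad.Coalgebra.Hom.ext E.e_tensorUnit
  d_tensor X Y := Comonad.Coalgebra.Hom.ext (by
    rw [Comonad.Coalgebra.comp_f, tensorμ_f]
    change ((X.a ⊗ₘ Y.a) ≫ μ E.toFunctor X.A Y.A) ≫ E.d (X.A ⊗ Y.A) ≫
      (E.toComonad.ε.app (X.A ⊗ Y.A) ⊗ₘ E.toComonad.ε.app (X.A ⊗ Y.A)) =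
      (coalgD X ⊗ₘ coalgD Y) ≫ tensorμ X.A X.A Y.A Y.A
    rw [Category.assoc, reassoc_of% E.d_tensor, tensorHom_comp_tensorHom, μ_counit,
      coalgD, coalgD, ← tensorμ_natural]
    simp only [tensorHom_comp_tensorHom_assoc]
    rfl)
  d_tensorUnit := Comonad.Coalgebra.Hom.ext (by
    change ε E.toFunctor ≫ E.d (𝟙_ L) ≫
      (E.toComonad.ε.app (𝟙_ L) ⊗ₘ E.toComonad.ε.app (𝟙_ L)) = (λ_ (𝟙_ L)).inv
    rw [reassoc_of% E.d_tensorUnit, tensorHom_comp_tensorHom, ε_counit]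
    simp)
  counit_left X := Comonad.Coalgebra.Hom.ext (by
    rw [Comonad.Coalgebra.comp_f, whiskerRight_f]
    change coalgD X ≫ (coalgE X ▷ X.A) = (λ_ X.A).inv
    -- The untouched factor is written as coaction followed by counit, so that `coalgD_comp` moves
    -- the law to the comonoid `!X`.
    have h : (coalgE X ▷ X.A) = (X.a ⊗ₘ X.a) ≫ (E.e X.A ▷ E.obj X.A) ≫
        (𝟙_ L ◁ E.toComonad.ε.app X.A) := by
      rw [← MonoidalCategory.tensorHom_def, tensorHom_comp_tensorHom, coalg_counit, tensorHom_id,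
        coalgE]
    rw [h, reassoc_of% coalgD_comp, reassoc_of% E.counit_left, ← leftUnitor_inv_naturality,
      reassoc_of% coalg_counit]
    rfl)
  counit_right X := Comonad.Coalgebra.Hom.ext (by
    rw [Comonad.Coalgebra.comp_f, whiskerLeft_f]
    change coalgD X ≫ (X.A ◁ coalgE X) = (ρ_ X.A).inv
    have h : (X.A ◁ coalgE X) = (X.a ⊗ₘ X.a) ≫ (E.obj X.A ◁ E.e X.A) ≫
        (E.toComonad.ε.app X.A ▷ 𝟙_ L) := by
      rw [← MonoidalCategory.tensorHom_def', tensorHom_comp_tensorHom, coalg_counit, id_tensorHom,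
        coalgE]
    rw [h, reassoc_of% coalgD_comp, reassoc_of% E.counit_right, ← rightUnitor_inv_naturality,
      reassoc_of% coalg_counit]
    rfl)
  coassoc X := Comonad.Coalgebra.Hom.ext (by
    simp only [Comonad.Coalgebra.comp_f, whiskerLeft_f, whiskerRight_f]
    change coalgD X ≫ (coalgD X ▷ X.A) ≫ (α_ X.A X.A X.A).hom = coalgD X ≫ (X.A ◁ coalgD X)
    apply coalg_mono
    have h1 : (coalgD X ▷ X.A) ≫ ((X.a ⊗ₘ X.a) ⊗ₘ X.a) =
        (X.a ⊗ₘ X.a) ≫ (E.d X.A ▷ E.obj X.A) := by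
      rw [← tensorHom_id, ← tensorHom_id, tensorHom_comp_tensorHom, tensorHom_comp_tensorHom,
        coalgD_comp, Category.id_comp, Category.comp_id]
    have h2 : (X.A ◁ coalgD X) ≫ (X.a ⊗ₘ X.a ⊗ₘ X.a) =
        (X.a ⊗ₘ X.a) ≫ (E.obj X.A ◁ E.d X.A) := by
      rw [← id_tensorHom, ← id_tensorHom, tensorHom_comp_tensorHom, tensorHom_comp_tensorHom,
        coalgD_comp, Category.id_comp, Category.comp_id]
    rw [Category.assoc, Category.assoc, Category.assoc, ← associator_naturality,
      reassoc_of% h1, h2, reassoc_of% coalgD_comp, reassoc_of% coalgD_comp, E.comonoid_coassoc])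
  cocomm X := Comonad.Coalgebra.Hom.ext (by
    change coalgD X ≫ (β_ X.A X.A).hom = coalgD X
    rw [coalgD, Category.assoc, Category.assoc, BraidedCategory.braiding_naturality,
      reassoc_of% E.cocomm])

end LinearExponentialComonad

/-! ### The forgetful–cofree adjunction is symmetric monoidal -/

namespace LinearExponentialComonad

variable {L : Type u} [Category.{v} L] [MonoidalCategory L] [SymmetricCategory L]
  (E : LinearExponentialComonad L)

open Functor.LaxMonoidal

/-- The forgetful functor from coalgebras is strict symmetric monoidal. -/
instance forgetLaxBraided : E.forget.LaxBraided where
  ε := 𝟙 (𝟙_ L)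
  μ X Y := 𝟙 (X.A ⊗ Y.A)
  μ_natural_left f X :=
    (Category.comp_id _).trans ((whiskerRight_f f X).symm.trans (Category.id_comp _).symm)
  μ_natural_right X f :=
    (Category.comp_id _).trans ((whiskerLeft_f X f).symm.trans (Category.id_comp _).symm)
  associativity X Y Z := by
    change (𝟙 (X.A ⊗ Y.A) ▷ Z.A) ≫ 𝟙 ((X.A ⊗ Y.A) ⊗ Z.A) ≫ (α_ X.A Y.A Z.A).hom =
      (α_ X.A Y.A Z.A).hom ≫ (X.A ◁ 𝟙 (Y.A ⊗ Z.A)) ≫ 𝟙 (X.A ⊗ Y.A ⊗ Z.A)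
    simp
  left_unitality X := by
    change (λ_ X.A).hom = (𝟙 (𝟙_ L) ▷ X.A) ≫ 𝟙 (𝟙_ L ⊗ X.A) ≫ (λ_ X.A).hom
    simp
  right_unitality X := by
    change (ρ_ X.A).hom = (X.A ◁ 𝟙 (𝟙_ L)) ≫ 𝟙 (X.A ⊗ 𝟙_ L) ≫ (ρ_ X.A).hom
    simp
  braided X Y := by
    change 𝟙 (X.A ⊗ Y.A) ≫ (β_ X.A Y.A).hom = (β_ X.A Y.A).hom ≫ 𝟙 (Y.A ⊗ X.A)
    simp

/-- The cofree functor to coalgebras is symmetric monoidal. -/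
instance cofreeLaxBraided : E.cofree.LaxBraided where
  ε := { f := ε E.toFunctor, h := E.ε_comult.symm }
  μ A B :=
    { f := μ E.toFunctor A B
      h := (Category.assoc _ _ _).trans (E.μ_comult A B).symm }
  μ_natural_left f A := Comonad.Coalgebra.Hom.ext (by
    rw [Comonad.Coalgebra.comp_f, whiskerRight_f]
    exact μ_natural_left E.toFunctor f A)
  μ_natural_right A f := Comonad.Coalgebra.Hom.ext (by
    rw [Comonad.Coalgebra.comp_f, whiskerLeft_f]
    exact μ_natural_right E.toFunctor A f)
  associativity A B C := Comonad.Coalgebra.Hom.ext (by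
    simp only [Comonad.Coalgebra.comp_f, whiskerLeft_f, whiskerRight_f]
    exact associativity E.toFunctor A B C)
  left_unitality A := Comonad.Coalgebra.Hom.ext (by
    simp only [Comonad.Coalgebra.comp_f, whiskerRight_f]
    exact left_unitality E.toFunctor A)
  right_unitality A := Comonad.Coalgebra.Hom.ext (by
    simp only [Comonad.Coalgebra.comp_f, whiskerLeft_f]
    exact right_unitality E.toFunctor A)
  braided A B := Comonad.Coalgebra.Hom.ext (Functor.LaxBraided.braided (F := E.toFunctor) A B)

lemma adj_unit_f (X : Coalg E) : (E.toComonad.adj.unit.app X).f = X.a := by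
  simp only [Comonad.adj_unit]
  simp
  rfl

lemma adj_counit_app (A : L) : E.toComonad.adj.counit.app A = E.toComonad.ε.app A := by
  simp
  rfl

/-- The symmetric monoidal adjunction between coalgebras and the linear category. -/
def coalgAdjunction : SymMonoidalAdjunction E.forget E.cofree where
  adj := E.toComonad.adj
  unit_monoidal :=
    { unit := Comonad.Coalgebra.Hom.ext (by
        rw [Comonad.Coalgebra.comp_f, adj_unit_f]
        exact (Category.id_comp _).trans ((Category.comp_id _).symm.trans
          (congrArg (ε E.toFunctor ≫ ·) (E.map_id (𝟙_ L)).symm)))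
      tensor := fun X Y => Comonad.Coalgebra.Hom.ext (by
        rw [Comonad.Coalgebra.comp_f, adj_unit_f, Comonad.Coalgebra.comp_f, tensorHom_f,
          adj_unit_f, adj_unit_f]
        change 𝟙 (X.A ⊗ Y.A) ≫ (X.a ⊗ₘ Y.a) ≫ μ E.toFunctor X.A Y.A =
          (X.a ⊗ₘ Y.a) ≫ μ E.toFunctor X.A Y.A ≫ E.map (𝟙 (X.A ⊗ Y.A))
        simp) }
  counit_monoidal :=
    { unit := by
        rw [adj_counit_app]
        change (𝟙 (𝟙_ L) ≫ ε E.toFunctor) ≫ E.toComonad.ε.app (𝟙_ L) = 𝟙 (𝟙_ L)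
        rw [Category.id_comp, ε_counit]
      tensor := fun A B => by
        rw [adj_counit_app, adj_counit_app, adj_counit_app]
        change (𝟙 (E.obj A ⊗ E.obj B) ≫ μ E.toFunctor A B) ≫ E.toComonad.ε.app (A ⊗ B) =
          (E.toComonad.ε.app A ⊗ₘ E.toComonad.ε.app B) ≫ 𝟙 (A ⊗ B)
        rw [Category.id_comp, μ_counit]
        exact (Category.comp_id _).symm }

end LinearExponentialComonad

/-! ### Opposites and composites of adjunctions -/

section Comonoidal

open Functor.OplaxMonoidal Functor.LaxMonoidal

variable {X : Type u₁} [Category.{v₁} X] [MonoidalCategory X] [SymmetricCategory X]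
  {Y : Type u₂} [Category.{v₂} Y] [MonoidalCategory Y] [SymmetricCategory Y]
  {Z : Type u₃} [Category.{v₃} Z] [MonoidalCategory Z] [SymmetricCategory Z]

/-- The opposite of a symmetric monoidal functor is symmetric comonoidal. -/
instance oplaxBraidedOp (F : X ⥤ Y) [F.LaxBraided] : OplaxBraided F.op where
  η := (ε F).op
  δ A B := (μ F (unop A) (unop B)).op
  δ_natural_left f A := Quiver.Hom.unop_inj (μ_natural_left F f.unop (unop A))
  δ_natural_right A f := Quiver.Hom.unop_inj (μ_natural_right F (unop A) f.unop)
  oplax_associativity A B C := Quiver.Hom.unop_inj (by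
    have h := associativity_inv F (unop A) (unop B) (unop C)
    rw [← Category.assoc, ← Category.assoc] at h
    exact h.symm)
  oplax_left_unitality A := Quiver.Hom.unop_inj (by
    have h := left_unitality F (unop A)
    rw [← Category.assoc] at h
    exact h)
  oplax_right_unitality A := Quiver.Hom.unop_inj (by
    have h := right_unitality F (unop A)
    rw [← Category.assoc] at h
    exact h)
  braided A B := Quiver.Hom.unop_inj (Functor.LaxBraided.braided (F := F) (unop B) (unop A)).symm

/-- The opposite of a symmetric monoidal adjunction. -/
def SymMonoidalAdjunction.op {F : X ⥤ Y} {G : Y ⥤ X} (A : SymMonoidalAdjunction F G) :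
    SymComonoidalAdjunction G.op F.op :=
  letI := A.leftLax
  letI := A.rightLax
  { adj := A.adj.op
    -- Passing to opposites exchanges unit and counit.
    unit_comonoidal :=
      { unit := Quiver.Hom.unop_inj A.counit_monoidal.unit
        tensor := fun P Q => Quiver.Hom.unop_inj (A.counit_monoidal.tensor (unop P) (unop Q)) }
    counit_comonoidal :=
      { unit := Quiver.Hom.unop_inj A.unit_monoidal.unit
        tensor := fun P Q => Quiver.Hom.unop_inj (A.unit_monoidal.tensor (unop P) (unop Q)) } }

instance oplaxBraidedComp (F : X ⥤ Y) (G : Y ⥤ Z) [OplaxBraided F] [OplaxBraided G] :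
    OplaxBraided (F ⋙ G) where
  braided A B := by
    have h := OplaxBraided.braided (F := F) A B
    have h' := OplaxBraided.braided (F := G) (F.obj A) (F.obj B)
    change (G.map (δ F A B) ≫ δ G (F.obj A) (F.obj B)) ≫ _ =
      G.map (F.map (β_ A B).hom) ≫ G.map (δ F B A) ≫ δ G (F.obj B) (F.obj A)
    rw [Category.assoc, ← G.map_comp_assoc, ← h, G.map_comp, Category.assoc, ← h']
    rfl

/-- The composite of symmetric comonoidal adjunctions. -/
def SymComonoidalAdjunction.comp {F : X ⥤ Y} {G : Y ⥤ X} {H : Y ⥤ Z} {I : Z ⥤ Y}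
    (A : SymComonoidalAdjunction F G) (B : SymComonoidalAdjunction H I) :
    SymComonoidalAdjunction (F ⋙ H) (I ⋙ G) :=
  letI := A.leftOplax
  letI := A.rightOplax
  letI := B.leftOplax
  letI := B.rightOplax
  { adj := A.adj.comp B.adj
    unit_comonoidal :=
      { unit := by
          have h : A.adj.unit.app (𝟙_ X) ≫ G.map (η F) ≫ η G = 𝟙 (𝟙_ X) :=
            A.unit_comonoidal.unit
          have h' : B.adj.unit.app (𝟙_ Y) ≫ I.map (η H) ≫ η I = 𝟙 (𝟙_ Y) :=
            B.unit_comonoidal.unit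
          rw [Adjunction.comp_unit_app]
          change (A.adj.unit.app (𝟙_ X) ≫ G.map (B.adj.unit.app (F.obj (𝟙_ X)))) ≫
            G.map (I.map (H.map (η F) ≫ η H)) ≫ G.map (η I) ≫ η G = 𝟙 (𝟙_ X)
          -- Naturality moves the unit of `B` past the structure map of `F`; the law for `B` then
          -- applies inside `G`, leaving the law for `A`.
          have hn : B.adj.unit.app (F.obj (𝟙_ X)) ≫ I.map (H.map (η F)) =
            η F ≫ B.adj.unit.app (𝟙_ Y) := (B.adj.unit.naturality (η F)).symm
          have hd : B.adj.unit.app (F.obj (𝟙_ X)) ≫ I.map (H.map (η F) ≫ η H) ≫ η I = η F := by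
            rw [I.map_comp, Category.assoc, reassoc_of% hn, h']
            exact Category.comp_id (η F)
          rw [Category.assoc, ← G.map_comp_assoc, ← G.map_comp_assoc]
          simp only [Category.assoc]
          exact (congrArg (fun t => A.adj.unit.app (𝟙_ X) ≫ G.map t ≫ η G) hd).trans h
        tensor := fun P Q => by
          let u (R : Y) : R ⟶ I.obj (H.obj R) := B.adj.unit.app R
          let w (R : X) : R ⟶ G.obj (F.obj R) := A.adj.unit.app R
          have h : w (P ⊗ Q) ≫ G.map (δ F P Q) ≫ δ G _ _ = (w P ⊗ₘ w Q) :=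
            (A.unit_comonoidal.tensor P Q).trans (Category.id_comp _)
          have h' : u (F.obj P ⊗ F.obj Q) ≫ I.map (δ H _ _) ≫ δ I _ _ =
              (u (F.obj P) ⊗ₘ u (F.obj Q)) :=
            (B.unit_comonoidal.tensor (F.obj P) (F.obj Q)).trans (Category.id_comp _)
          have hn : u (F.obj (P ⊗ Q)) ≫ I.map (H.map (δ F P Q)) =
            δ F P Q ≫ u (F.obj P ⊗ F.obj Q) := (B.adj.unit.naturality (δ F P Q)).symm
          have hd : G.map (u (F.obj P) ⊗ₘ u (F.obj Q)) ≫ δ G _ _ =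
            δ G _ _ ≫ (G.map (u (F.obj P)) ⊗ₘ G.map (u (F.obj Q))) := (δ_natural G _ _).symm
          have key : (w (P ⊗ Q) ≫ G.map (u (F.obj (P ⊗ Q)))) ≫
              G.map (I.map (H.map (δ F P Q) ≫ δ H _ _)) ≫ G.map (δ I _ _) ≫ δ G _ _ =
              (w P ≫ G.map (u (F.obj P))) ⊗ₘ (w Q ≫ G.map (u (F.obj Q))) := by
            rw [Category.assoc, ← G.map_comp_assoc, ← G.map_comp_assoc, I.map_comp,
              Category.assoc, Category.assoc, reassoc_of% hn, h', G.map_comp_assoc, hd,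
              reassoc_of% h, tensorHom_comp_tensorHom]
          rw [Adjunction.comp_unit_app, Adjunction.comp_unit_app, Adjunction.comp_unit_app]
          exact key.trans (Category.id_comp _).symm }
    counit_comonoidal :=
      { unit := by
          have h : A.adj.counit.app (𝟙_ Y) = F.map (η G) ≫ η F :=
            (Category.comp_id _).symm.trans A.counit_comonoidal.unit
          have h' : B.adj.counit.app (𝟙_ Z) = H.map (η I) ≫ η H :=
            (Category.comp_id _).symm.trans B.counit_comonoidal.unit
          have hn : F.map (G.map (η I)) ≫ A.adj.counit.app (𝟙_ Y) =
            A.adj.counit.app (I.obj (𝟙_ Z)) ≫ η I := A.adj.counit.naturality (η I)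
          have key : H.map (A.adj.counit.app (I.obj (𝟙_ Z))) ≫ B.adj.counit.app (𝟙_ Z) =
              H.map (F.map (G.map (η I) ≫ η G)) ≫ H.map (η F) ≫ η H := by
            rw [h', ← H.map_comp_assoc, ← H.map_comp_assoc, ← hn, h, F.map_comp, Category.assoc]
          rw [Adjunction.comp_counit_app]
          exact (Category.comp_id _).trans key
        tensor := fun P Q => by
          let u (R : Z) : H.obj (I.obj R) ⟶ R := B.adj.counit.app R
          let w (R : Y) : F.obj (G.obj R) ⟶ R := A.adj.counit.app R
          have h : w (I.obj P ⊗ I.obj Q) = (F.map (δ G _ _) ≫ δ F _ _) ≫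
              (w (I.obj P) ⊗ₘ w (I.obj Q)) :=
            (Category.comp_id _).symm.trans (A.counit_comonoidal.tensor (I.obj P) (I.obj Q))
          have h' : u (P ⊗ Q) = (H.map (δ I _ _) ≫ δ H _ _) ≫ (u P ⊗ₘ u Q) :=
            (Category.comp_id _).symm.trans (B.counit_comonoidal.tensor P Q)
          have hn : F.map (G.map (δ I P Q)) ≫ w (I.obj P ⊗ I.obj Q) =
            w (I.obj (P ⊗ Q)) ≫ δ I P Q := A.adj.counit.naturality (δ I P Q)
          have hd : H.map (w (I.obj P) ⊗ₘ w (I.obj Q)) ≫ δ H _ _ =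
            δ H _ _ ≫ (H.map (w (I.obj P)) ⊗ₘ H.map (w (I.obj Q))) := (δ_natural H _ _).symm
          have key : H.map (w (I.obj (P ⊗ Q))) ≫ u (P ⊗ Q) =
              (H.map (F.map (G.map (δ I P Q) ≫ δ G _ _)) ≫ H.map (δ F _ _) ≫ δ H _ _) ≫
              ((H.map (w (I.obj P)) ≫ u P) ⊗ₘ (H.map (w (I.obj Q)) ≫ u Q)) := by
            rw [h', Category.assoc, ← H.map_comp_assoc, ← hn, h, H.map_comp, H.map_comp,
              ← tensorHom_comp_tensorHom, Category.assoc, Category.assoc, reassoc_of% hd]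
            simp only [Functor.map_comp, Category.assoc]
          rw [Adjunction.comp_counit_app, Adjunction.comp_counit_app, Adjunction.comp_counit_app]
          exact (Category.comp_id _).trans key } }

end Comonoidal

/-! ### Monoidal equivalences as comonoidal adjunctions -/

section Strong

open Functor.OplaxMonoidal Functor.LaxMonoidal

variable {X : Type u₁} [Category.{v₁} X] [MonoidalCategory X]
  {Y : Type u₂} [Category.{v₂} Y] [MonoidalCategory Y]

/-- A monoidal natural transformation between strong monoidal functors is comonoidal. -/
lemma IsComonoidal.of_isMonoidal {F G : X ⥤ Y} [F.Monoidal] [G.Monoidal] (τ : F ⟶ G)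
    (h : NatTrans.IsMonoidal τ) : IsComonoidal τ where
  unit := by
    rw [← cancel_epi (ε F), reassoc_of% h.unit]
    simp
  tensor A B := by
    rw [← cancel_epi (μ F A B), reassoc_of% h.tensor A B]
    simp

/-- A braided strong monoidal functor is symmetric comonoidal. -/
@[reducible]
def OplaxBraided.ofBraided [SymmetricCategory X] [SymmetricCategory Y] (F : X ⥤ Y) [F.Braided] :
    OplaxBraided F where
  braided A B := by
    have h := Functor.LaxBraided.braided (F := F) A B
    rw [← cancel_epi (μ F A B), reassoc_of% h]
    simp

/-- A monoidal equivalence is a symmetric comonoidal adjunction. -/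
def SymComonoidalAdjunction.ofEquivalence [SymmetricCategory X] [SymmetricCategory Y]
    (e : X ≌ Y) [e.functor.Braided] [e.inverse.Braided] [e.IsMonoidal] :
    SymComonoidalAdjunction e.functor e.inverse :=
  letI := OplaxBraided.ofBraided e.functor
  letI := OplaxBraided.ofBraided e.inverse
  { adj := e.toAdjunction
    unit_comonoidal :=
      IsComonoidal.of_isMonoidal e.unit inferInstance
    counit_comonoidal :=
      IsComonoidal.of_isMonoidal e.counit inferInstance }

end Strong

/-- The symmetric comonoidal adjunction given by a transported structure. -/
noncomputable def transportedAdjunction {X : Type u₁} [Category.{v₁} X] [MonoidalCategory X]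
    [SymmetricCategory X] {Y : Type u₂} [Category.{v₂} Y] (e : X ≌ Y) :
    @SymComonoidalAdjunction Y _ (Monoidal.transport e)
      (Monoidal.Transported.instSymmetricCategory e) X _ _ _ e.inverse e.functor :=
  -- Reversing the equivalence makes `e.inverse` the left adjoint, the direction required of `⌊-⌋`.
  letI : (Monoidal.equivalenceTransported e).symm.functor.Braided :=
    inferInstanceAs (Monoidal.equivalenceTransported e).inverse.Braided
  letI : (Monoidal.equivalenceTransported e).symm.inverse.Braided :=
    inferInstanceAs (Monoidal.equivalenceTransported e).functor.Braided
  SymComonoidalAdjunction.ofEquivalence (Monoidal.equivalenceTransported e).symm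

/-! ### The duality between a category and its opposite -/

section Opposite

variable {P : Type u} [Category.{v} P] [MonoidalCategory P] [SymmetricCategory P]

/-- The identity `(Pᵒᵖ)ᵒᵖ ⥤ P` is symmetric comonoidal. -/
instance unopUnopOplaxBraided : OplaxBraided (unopUnop P) where
  η := 𝟙 (𝟙_ P)
  δ A B := 𝟙 (unop (unop A) ⊗ unop (unop B))
  δ_natural_left f A := (Category.id_comp _).trans (Category.comp_id _).symm
  δ_natural_right A f := (Category.id_comp _).trans (Category.comp_id _).symm
  oplax_associativity A B C := by
    change 𝟙 _ ≫ (𝟙 (unop (unop A) ⊗ unop (unop B)) ▷ _) ≫ (α_ _ _ _).hom =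
      (α_ _ _ _).hom ≫ 𝟙 _ ≫ _ ◁ 𝟙 (unop (unop B) ⊗ unop (unop C))
    simp
  oplax_left_unitality A := by
    change (λ_ (unop (unop A))).inv = (λ_ (unop (unop A))).inv ≫ 𝟙 _ ≫ 𝟙 (𝟙_ P) ▷ _
    simp
  oplax_right_unitality A := by
    change (ρ_ (unop (unop A))).inv = (ρ_ (unop (unop A))).inv ≫ 𝟙 _ ≫ _ ◁ 𝟙 (𝟙_ P)
    simp
  braided A B := (Category.id_comp _).trans (Category.comp_id _).symm

/-- The tautological duality between a symmetric monoidal category and its opposite. -/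
def opDuality : SymMonoidalDuality P Pᵒᵖ where
  star := 𝟭 Pᵒᵖ
  lowerStar := unopUnop P
  counit := Iso.refl _
  unit := Iso.refl _
  star_unit _ := rfl
  lowerStar_counit _ := rfl
  counit_tensor Y Z := by
    change 𝟙 (Y ⊗ Z) ≫ 𝟙 (Y ⊗ Z) ≫ 𝟙 (Y ⊗ Z) = 𝟙 Y ⊗ₘ 𝟙 Z
    simp
  counit_tensorUnit := by
    change 𝟙 (𝟙_ Pᵒᵖ) ≫ 𝟙 (𝟙_ Pᵒᵖ) ≫ 𝟙 (𝟙_ Pᵒᵖ) = _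
    simp
  unit_tensor Y Z := by
    change 𝟙 (Y ⊗ Z) ≫ 𝟙 (Y ⊗ Z) ≫ 𝟙 (Y ⊗ Z) = 𝟙 Y ⊗ₘ 𝟙 Z
    simp
  unit_tensorUnit := by
    change 𝟙 (𝟙_ P) ≫ 𝟙 (𝟙_ P) ≫ 𝟙 (𝟙_ P) = _
    simp

/-- Natural comonoids are natural monoids in the opposite category. -/
def NaturalComonoids.op (N : NaturalComonoids P) : NaturalMonoids Pᵒᵖ where
  e X := (N.e (unop X)).op
  d X := (N.d (unop X)).op
  e_naturality f := Quiver.Hom.unop_inj (N.e_naturality f.unop)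
  d_naturality f := Quiver.Hom.unop_inj (N.d_naturality f.unop)
  e_tensor X Y := Quiver.Hom.unop_inj (N.e_tensor (unop X) (unop Y))
  e_tensorUnit := Quiver.Hom.unop_inj N.e_tensorUnit
  d_tensor X Y := Quiver.Hom.unop_inj ((N.d_tensor (unop X) (unop Y)).trans (by
    congr 1
    -- The middle-four interchange is inverted by exchanging the middle factors again, so its
    -- opposite is again an interchange.
    change tensorμ (unop X) (unop X) (unop Y) (unop Y) = (tensorμ X Y X Y).unop
    simp [tensorμ]))
  d_tensorUnit := Quiver.Hom.unop_inj N.d_tensorUnit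
  unit_left X := Quiver.Hom.unop_inj (N.counit_left (unop X))
  unit_right X := Quiver.Hom.unop_inj (N.counit_right (unop X))
  assoc X := Quiver.Hom.unop_inj (by
    have h := N.coassoc (unop X)
    rw [← Category.assoc, ← Iso.eq_comp_inv] at h
    exact h)
  comm X := Quiver.Hom.unop_inj (N.cocomm (unop X))

end Opposite

/-- A *-autonomous category with finite products has finite coproducts. -/
lemma hasFiniteCoproducts_of_dual {L : Type u} [Category.{v} L] [MonoidalCategory L]
    [SymmetricCategory L] [MonoidalClosed L] (D : L) [∀ A : L, IsIso (toDoubleDual D A)]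
    [Limits.HasFiniteProducts L] : Limits.HasFiniteCoproducts L :=
  ⟨fun _ => Adjunction.hasColimitsOfShape_of_equivalence (dualEquivalence D).inverse⟩

/-! ### Assembling the model -/

section Model

variable {L : Type u} [Category.{v} L] [MonoidalCategory L] [SymmetricCategory L]
  [MonoidalClosed L] (D : L) [∀ A : L, IsIso (toDoubleDual D A)]
  (E : LinearExponentialComonad L)

/-- The comonoidal adjunction between the linear category and the opposite of the coalgebras. -/
noncomputable def consumingAdjunction :
    @SymComonoidalAdjunction L _ (dualCotensor D).mon (dualCotensor D).symm E.Coalgᵒᵖ _ _ _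
      ((dualFunctor D).rightOp ⋙ E.cofree.op) (E.forget.op ⋙ dualFunctor D) :=
  @SymComonoidalAdjunction.comp L _ (dualCotensor D).mon (dualCotensor D).symm Lᵒᵖ _ _ _
    E.Coalgᵒᵖ _ _ _ _ _ _ _ (transportedAdjunction (dualEquivalence D)) E.coalgAdjunction.op

/-- The LPC model of coalgebras of a linear exponential comonad. -/
noncomputable def coalgebraModel [Limits.HasFiniteProducts L] :
    LPCModel L E.Coalg E.Coalgᵒᵖ where
  lin := (dualEvaluationCotensor D).linearDistributiveNeg
  finiteProducts := inferInstance
  finiteCoproducts := hasFiniteCoproducts_of_dual D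
  dual := opDuality
  comonoids := E.coalgComonoids
  monoids := E.coalgComonoids.op
  star_e _ := Category.id_comp _
  star_d _ := Category.id_comp _
  lowerStar_e _ := Category.comp_id _
  lowerStar_d _ := Category.comp_id _
  bang := E.cofree
  freeBang := E.forget
  whyNot := (dualFunctor D).rightOp ⋙ E.cofree.op
  freeWhyNot := E.forget.op ⋙ dualFunctor D
  producing := E.coalgAdjunction
  consuming := consumingAdjunction D E
  negFreeBang X := Iso.refl (dual D X.A)
  negFreeBang_naturality f := by
    rw [EvaluationCotensor.linearDistributiveNeg_negMap]
    exact (Category.comp_id _).trans (Category.id_comp _).symm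
  -- `⌊A^⊥⌋` is the cofree coalgebra on the double dual of `A`, so reflexivity supplies the
  -- isomorphism; `negFreeBang`, in contrast, is an identity.
  starBang A := (E.cofree.mapIso (bidual D A)).symm.op
  starBang_naturality {A B} f := by
    rw [EvaluationCotensor.linearDistributiveNeg_negMap]
    have h := bidual_naturality D f
    rw [← Iso.inv_comp_eq, ← Category.assoc, ← Iso.eq_comp_inv] at h
    have h' := congrArg E.cofree.map h
    rw [Functor.map_comp, Functor.map_comp] at h'
    exact Quiver.Hom.unop_inj h'

open Functor.LaxMonoidal in
-- Forgetting a cofree coalgebra gives `!` on the nose, so the identity serves as the isomorphism.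
-- The comonoid of a cofree coalgebra is the given one by `δ_e`, `δ_d` and the counit law of the
-- comonad.
lemma coalgebraModel_decomposes [Limits.HasFiniteProducts L] :
    (coalgebraModel D E).Decomposes E := by
  have hl (A : L) : E.toComonad.δ.app A ≫ E.toComonad.ε.app (E.obj A) = 𝟙 (E.obj A) :=
    E.toComonad.left_counit A
  have hm : NatTrans.IsMonoidal (F₁ := E.cofree ⋙ E.forget) (F₂ := E.toFunctor)
      (𝟙 E.toFunctor) :=
    { unit := (Category.comp_id _).trans (Category.id_comp (ε E.toFunctor))
      tensor := fun A B => by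
        have h : (𝟙 (E.obj A ⊗ E.obj B) ≫ μ E.toFunctor A B) ≫ 𝟙 (E.obj (A ⊗ B)) =
          (𝟙 (E.obj A) ⊗ₘ 𝟙 (E.obj B)) ≫ μ E.toFunctor A B := by simp
        exact h }
  refine ⟨Iso.refl E.toFunctor, fun A => ?_, fun A => ?_, hm, fun A => ?_, fun A => ?_⟩
  · exact (Category.id_comp _).trans (E.adj_counit_app A).symm
  · have h {B : L} (f : B ⟶ E.obj (E.obj A)) :
        f = f ≫ 𝟙 (E.obj (E.obj A)) ≫ E.map (𝟙 (E.obj A)) := by simp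
    refine (Category.id_comp _).trans ((h (E.toComonad.δ.app A)).trans ?_)
    exact congrArg (fun t => t ≫ 𝟙 (E.obj (E.obj A)) ≫ E.map (𝟙 (E.obj A)))
      (E.adj_unit_f (E.cofree.obj A)).symm
  · have h : E.toComonad.δ.app A ≫ E.e (E.obj A) = 𝟙 (E.obj A) ≫ E.e A ≫ 𝟙 (𝟙_ L) := by
      rw [Category.id_comp, Category.comp_id, E.δ_e]
    exact h
  · have h : E.toComonad.δ.app A ≫ E.d (E.obj A) ≫
        (E.toComonad.ε.app (E.obj A) ⊗ₘ E.toComonad.ε.app (E.obj A)) =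
        𝟙 (E.obj A) ≫ E.d A ≫ (𝟙 (E.obj A) ⊗ₘ 𝟙 (E.obj A)) ≫ 𝟙 (E.obj A ⊗ E.obj A) := by
      rw [reassoc_of% E.δ_d A, tensorHom_comp_tensorHom, hl]
      simp
    exact h

end Model

end LPC

theorem mainTheorem6 {L : Type u} [Category.{v} L] [MonoidalCategory L] [SymmetricCategory L]
    (S : LPC.ClassicalLinearModel L) :
    ∃ (P : Type (max u v)) (_ : Category.{v} P) (_ : MonoidalCategory P)
      (_ : SymmetricCategory P) (M : LPC.LPCModel L P Pᵒᵖ),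
      M.HasNegationOf S ∧ M.Decomposes S.bang := by
  let := S.closed
  have := S.isIso_toDoubleDual
  have := S.finiteProducts
  refine ⟨S.bang.Coalg, inferInstance, inferInstance, inferInstance,
    LPC.coalgebraModel S.dualizing S.bang,
    -- The negation is literally `A ⊸ ⊥`; only the unit of the cotensor, `1 ⊸ ⊥`, has to be
    -- identified with `⊥`, which undoes the correction built into `ev`.
    ⟨LPC.dualUnitIso S.dualizing, fun A => ⟨Iso.refl (LPC.dual S.dualizing A), ?_⟩⟩,
    LPC.coalgebraModel_decomposes S.dualizing S.bang⟩
  have h : ((β_ (LPC.dual S.dualizing A) A).hom ≫ LPC.dualEv S.dualizing A ≫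
      (LPC.dualUnitIso S.dualizing).inv) ≫ (LPC.dualUnitIso S.dualizing).hom =
      (𝟙 (LPC.dual S.dualizing A) ▷ A) ≫ (β_ (LPC.dual S.dualizing A) A).hom ≫
        LPC.dualEv S.dualizing A := by simp
  exact h
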